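/- **Model.** Alice holds $x\in\mathcal X$ and Bob holds $y\in\mathcal Y$; they also share a uniformly random finite bit string. An adaptive protocol runs for a fixed number $R_{\max}$ of rounds (its round complexity). In every round each party either sends a symbol of a finite alphabet $\Sigma$ or stays silent, as a function of its own input, the shared string and the symbols and silences it has received so far. After round $R_{\max}$ each party gives an output, as a function of the same data. The adversary knows the protocol, the inputs $x,y$, her own random coins (independent of the shared string) and all transmissions so far, including those of the current round, but not the shared string. She may change any transmission: alter or delete a symbol, or insert one in place of a silence. The relative noise rate of an execution is the number of transmissions (silent ones included) that she changed, divided by the number of non-silent transmissions that the parties sent; it is $\infty$ if the denominator alone is $0$, and $0$ if both are $0$. $\mathsf{CC}_f$ denotes the deterministic (noiseless, bitwise) two-party communication complexity of $f$. **Theorem.** There is $\varepsilon_0>0$ such that for every $0<\varepsilon<\varepsilon_0$ there are a finite alphabet $\Sigma$ and constants $C\in\mathbb N$, $c>0$, depending only on $\varepsilon$, with the following property. For all non-empty finite sets $\mathcal X,\mathcal Y,\mathcal Z$ and every function $f:\mathcal X\times\mathcal Y\to\mathcal Z$ there is an adaptive protocol with shared randomness over $\Sigma$, with round complexity $R_{\max}\le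 C\cdot\mathsf{CC}_f$, such that for all inputs $(x,y)$ and every adversary, the probability (over the shared string and the adversary's coins) that the relative noise rate is at most $1-\varepsilon$ and yet not both parties output $f(x,y)$ is at most $2^{-c\,\mathsf{CC}_f}$. -/

import Mathlib

open scoped ENNReal

universe u v w

namespace AdaptiveComm

/-! ### Deterministic communication complexity (Yao's model, noiseless channel) -/

/-- A deterministic two-party protocol tree over a noiseless channel: at each inner node one of
the parties sends one bit that depends on its own input, and each leaf carries the output. -/
inductive ProtocolTree (X : Type*) (Y : Type*) (Z : Type*) where
  | leaf (z : Z) : ProtocolTree X Y Z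
  | alice (bit : X → Bool) (next₀ next₁ : ProtocolTree X Y Z) : ProtocolTree X Y Z
  | bob (bit : Y → Bool) (next₀ next₁ : ProtocolTree X Y Z) : ProtocolTree X Y Z

namespace ProtocolTree

variable {X Y Z : Type*}

/-- The worst-case number of bits exchanged. -/
def depth : ProtocolTree X Y Z → ℕ
  | leaf _ => 0
  | alice _ t₀ t₁ => max t₀.depth t₁.depth + 1
  | bob _ t₀ t₁ => max t₀.depth t₁.depth + 1

/-- The output on inputs `x`, `y`. -/
def eval : ProtocolTree X Y Z → X → Y → Z
  | leaf z, _, _ => z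
  | alice bit t₀ t₁, x, y => if bit x then t₁.eval x y else t₀.eval x y
  | bob bit t₀ t₁, x, y => if bit y then t₁.eval x y else t₀.eval x y

/-- The tree computes `f` on all inputs. -/
def Computes (t : ProtocolTree X Y Z) (f : X → Y → Z) : Prop :=
  ∀ x y, t.eval x y = f x y

end ProtocolTree

/-- `CC_f`: the deterministic communication complexity of `f`, that is, the least number of bits
that a noiseless protocol computing `f` exchanges in the worst case. -/
noncomputable def commComplexity {X Y Z : Type*} (f : X → Y → Z) : ℕ :=
  sInf {n | ∃ t : ProtocolTree X Y Z, t.Computes f ∧ t.depth = n}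

/-- The infimum that defines `commComplexity` is over a non-empty set. -/
theorem exists_computes {X Y Z : Type*} [Finite X] [Finite Y] [Nonempty X] [Nonempty Y]
    (f : X → Y → Z) : ∃ t : ProtocolTree X Y Z, t.Computes f := by
  classical
  cases nonempty_fintype X
  cases nonempty_fintype Y
  obtain ⟨x₀⟩ := ‹Nonempty X›
  obtain ⟨y₀⟩ := ‹Nonempty Y›
  have hB : ∀ x : X, ∀ s : Finset Y, ∃ t : ProtocolTree X Y Z,
      ∀ x', ∀ y ∈ s, t.eval x' y = f x y := by
    intro x s
    induction s using Finset.induction_on with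
    | empty => exact ⟨.leaf (f x₀ y₀), by simp⟩
    | insert a s _ ih =>
      obtain ⟨t, ht⟩ := ih
      refine ⟨.bob (fun y => decide (y = a)) t (.leaf (f x a)), fun x' y hy => ?_⟩
      by_cases h : y = a
      · simp [ProtocolTree.eval, h]
      · simpa [ProtocolTree.eval, h] using ht x' y (by simpa [h] using hy)
  choose g hg using fun x => hB x Finset.univ
  have hA : ∀ s : Finset X, ∃ t : ProtocolTree X Y Z, ∀ x ∈ s, ∀ y, t.eval x y = f x y := by
    intro s
    induction s using Finset.induction_on with
    | empty => exact ⟨.leaf (f x₀ y₀), by simp⟩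
    | insert a s _ ih =>
      obtain ⟨t, ht⟩ := ih
      refine ⟨.alice (fun x => decide (x = a)) t (g a), fun x hx y => ?_⟩
      by_cases h : x = a
      · simp [ProtocolTree.eval, h, hg]
      · simpa [ProtocolTree.eval, h] using ht x (by simpa [h] using hx) y
  obtain ⟨t, ht⟩ := hA Finset.univ
  exact ⟨t, fun x y => ht x (Finset.mem_univ x) y⟩

/-! ### The model with an adaptive order of communication -/

/-- What happens on the channel in one round. A value of type `Option Γ` is a symbol of the
alphabet `Γ` (`some γ`) or silence (`none`). -/
structure Round (Γ : Type*) where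
  /-- sent by Alice -/
  sentA : Option Γ
  /-- sent by Bob -/
  sentB : Option Γ
  /-- received by Alice (Bob's transmission after the channel) -/
  recvA : Option Γ
  /-- received by Bob (Alice's transmission after the channel) -/
  recvB : Option Γ

/-- A deterministic strategy of the adversary: from the rounds so far and the current
transmissions of Alice and of Bob, it determines what Bob receives in place of Alice's
transmission (first component) and what Alice receives in place of Bob's transmission (second
component). Symbols may be altered, deleted or inserted. -/
abbrev Adversary (Γ : Type*) : Type _ :=
  List (Round Γ) → Option Γ → Option Γ → Option Γ × Option Γ

/-- A protocol with an adaptive order of communication over the alphabet `Γ`, in which the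
parties share a string of `seedLen` bits. In each of the `rounds` rounds each party sends a
symbol or stays silent, depending on its own input, the shared string and what it has received in
the previous rounds (listed in order of time); after the last round both parties give an
output. -/
structure SharedProtocol (X : Type*) (Y : Type*) (Z : Type*) (Γ : Type*) where
  /-- the number of rounds, `R_max` -/
  rounds : ℕ
  /-- the length of the shared random string -/
  seedLen : ℕ
  sendA : X → (Fin seedLen → Bool) → List (Option Γ) → Option Γ
  sendB : Y → (Fin seedLen → Bool) → List (Option Γ) → Option Γ
  outA : X → (Fin seedLen → Bool) → List (Option Γ) → Z
  outB : Y → (Fin seedLen → Bool) → List (Option Γ) → Z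

namespace SharedProtocol

variable {X Y Z Γ : Type*}

/-- The first `n` rounds of the execution on inputs `x`, `y` with shared string `r` against the
adversary `eve`. -/
def history (P : SharedProtocol X Y Z Γ) (x : X) (y : Y) (r : Fin P.seedLen → Bool)
    (eve : Adversary Γ) : ℕ → List (Round Γ)
  | 0 => []
  | n + 1 =>
    let h := P.history x y r eve n
    let a := P.sendA x r (h.map Round.recvA)
    let b := P.sendB y r (h.map Round.recvB)
    h ++ [{ sentA := a, sentB := b, recvA := (eve h a b).2, recvB := (eve h a b).1 }]

/-- The whole execution. -/
def transcript (P : SharedProtocol X Y Z Γ) (x : X) (y : Y) (r : Fin P.seedLen → Bool)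
    (eve : Adversary Γ) : List (Round Γ) :=
  P.history x y r eve P.rounds

/-- Both parties output `f x y`. -/
def Correct (P : SharedProtocol X Y Z Γ) (f : X → Y → Z) (x : X) (y : Y)
    (r : Fin P.seedLen → Bool) (eve : Adversary Γ) : Prop :=
  P.outA x r ((P.transcript x y r eve).map Round.recvA) = f x y ∧
    P.outB y r ((P.transcript x y r eve).map Round.recvB) = f x y

end SharedProtocol

/-- Communication complexity of an execution: the number of transmissions that are not silence. -/
def communication {Γ : Type*} (h : List (Round Γ)) : ℕ :=
  (h.map fun ρ => (if ρ.sentA.isSome then 1 else 0) + (if ρ.sentB.isSome then 1 else 0)).sum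

open Classical in
/-- Noise complexity of an execution: the number of transmissions, silent ones included, that the
adversary changed. -/
noncomputable def noise {Γ : Type*} (h : List (Round Γ)) : ℕ :=
  (h.map fun ρ => (if ρ.recvB = ρ.sentA then 0 else 1) +
    (if ρ.recvA = ρ.sentB then 0 else 1)).sum

/-- Relative noise rate of an execution. It may exceed `1`; it is `∞` if there was noise but no
communication, and `0` if there was neither. -/
noncomputable def noiseRate {Γ : Type*} (h : List (Round Γ)) : ℝ≥0∞ :=
  (noise h : ℝ≥0∞) / (communication h : ℝ≥0∞)

/-- The probability, over a uniformly random shared string and the independent coins of the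
adversary (which select one of her deterministic strategies), that the relative noise rate is at
most `δ` and yet some party does not output `f x y`. -/
noncomputable def SharedProtocol.failureProb {X Y Z Γ : Type*} (P : SharedProtocol X Y Z Γ)
    (f : X → Y → Z) (δ : ℝ≥0∞) (x : X) (y : Y) (eve : PMF (Adversary Γ)) : ℝ≥0∞ :=
  ((PMF.uniformOfFintype (Fin P.seedLen → Bool)).bind
      fun r => eve.map fun e => (r, e)).toOuterMeasure
    {p | noiseRate (P.transcript x y p.1 p.2) ≤ δ ∧ ¬ P.Correct f x y p.1 p.2}

end AdaptiveComm

/-! The protocol runs in iterations of `reps + 1` rounds. In the opening round Alice sends one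
signed symbol; if Bob accepts it, he repeats one signed answer in the other `reps` rounds, and
otherwise he stays silent. Preventing Bob from accepting costs one corruption against a single
transmission. Preventing Alice from accepting, once Bob has accepted, costs `reps` corruptions
against `reps + 1` transmissions. Thus a noise rate of at most `1 - ε`, with `reps` of order `1 /
ε`, leaves a constant fraction of iterations in which both parties accept (`comm_le_noise`).

Each round has a fresh shared key that assigns a random tag to every symbol, and only one party is
scheduled to speak. The adversary therefore sees at most one value of the key, and a symbol other
than the one sent passes the check with probability at most `1 / |Tag|` (`card_forgery_le`). An
exponential moment bound shows that `n` forgeries are exponentially unlikely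
(`card_many_forged_le`), where `n` is the communication complexity. Apart from forgeries, every
corruption is merely an erasure or has no effect.

Each party encodes its operations on a path of the protocol tree by a tree code over an alphabet
independent of `n` (`exists_isTreeCode`). Decoding by maximal agreement ignores erasures, so it
fails in few of the iterations with an accepted symbol unless there are many forgeries
(`card_misdecoded_le`).

The parties extend, follow and retract their paths by a rule which, under correct beliefs, brings
the pair closer to the target path (`pathDist_move_move`); a decoding error costs at most two steps.
The target is prolonged beyond the depth of the tree to leave room for late errors, and only its
first `n` steps have to be reached (`le_lcp_walk`). -/

namespace AdaptiveComm

/-! ### Counting adapted events -/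

section Counting

variable {R : Type*} [Fintype R]

-- Redrawing one coordinate preserves the uniform distribution: exchanging the coordinate with the
-- fresh value is an involution.
open Classical in
theorem sum_sum_update {T : ℕ} (i : Fin T) (g : (Fin T → R) → ℕ) :
    ∑ ω : Fin T → R, ∑ r : R, g (Function.update ω i r) =
      Fintype.card R * ∑ ω : Fin T → R, g ω := by
  have key : ∑ p : (Fin T → R) × R, g (Function.update p.1 i p.2) =
      ∑ p : (Fin T → R) × R, g p.1 := by
    refine Fintype.sum_bijective (fun p : (Fin T → R) × R => (Function.update p.1 i p.2, p.1 i))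
      (Function.Involutive.bijective fun p => ?_) _ _ fun p => rfl
    ext <;> simp
  rw [Fintype.sum_prod_type, Fintype.sum_prod_type] at key
  rw [key, Finset.mul_sum]
  simp

open Classical in
/-- An exponential moment bound for the number of occurrences of adapted events, each of which has
conditional probability at most `1 / K`. -/
theorem sum_pow_card_le {T : ℕ} (K : ℕ) (hK : 0 < K) (bad : Fin T → (Fin T → R) → Prop)
    (hadapt : ∀ t ω ω', (∀ s ≤ t, ω s = ω' s) → (bad t ω ↔ bad t ω'))
    (hprob : ∀ t ω, (Finset.univ.filter fun r => bad t (Function.update ω t r)).card * K ≤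
      Fintype.card R) (l : ℕ) (hl : l ≤ T) :
    ∑ ω : Fin T → R, K ^ (Finset.univ.filter fun t : Fin T => (t : ℕ) < l ∧ bad t ω).card ≤
      2 ^ l * Fintype.card R ^ T := by
  induction l with
  | zero => simp
  | succ l ih =>
    rcases Nat.eq_zero_or_pos (Fintype.card R) with h0 | hpos
    · have : IsEmpty R := Fintype.card_eq_zero_iff.mp h0
      have : IsEmpty (Fin T → R) := ⟨fun ω => isEmptyElim (ω ⟨l, hl⟩)⟩
      simp
    set i : Fin T := ⟨l, hl⟩ with hi
    have ih' := ih (Nat.le_of_succ_le hl)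
    refine Nat.le_of_mul_le_mul_left ?_ hpos
    -- Averaging over a redrawn coordinate `l` leaves the earlier events fixed, so each conditioning
    -- step costs only a factor `2`.
    rw [← sum_sum_update i]
    have step : ∀ ω : Fin T → R, ∑ r : R, K ^ (Finset.univ.filter fun t : Fin T =>
        (t : ℕ) < l + 1 ∧ bad t (Function.update ω i r)).card ≤
        K ^ (Finset.univ.filter fun t : Fin T => (t : ℕ) < l ∧ bad t ω).card *
          (2 * Fintype.card R) := by
      intro ω
      have e1 : ∀ r, (Finset.univ.filter fun t : Fin T =>
          (t : ℕ) < l + 1 ∧ bad t (Function.update ω i r)).card ≤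
          (Finset.univ.filter fun t : Fin T => (t : ℕ) < l ∧ bad t ω).card +
            (if bad i (Function.update ω i r) then 1 else 0) := by
        intro r
        have hsub : (Finset.univ.filter fun t : Fin T =>
            (t : ℕ) < l + 1 ∧ bad t (Function.update ω i r)) ⊆
            (Finset.univ.filter fun t : Fin T => (t : ℕ) < l ∧ bad t ω) ∪
              (if bad i (Function.update ω i r) then {i} else ∅) := by
          intro t ht
          simp only [Finset.mem_filter, Finset.mem_univ, true_and, Finset.mem_union] at ht ⊢
          rcases Nat.lt_succ_iff_lt_or_eq.mp ht.1 with h | h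
          · left
            refine ⟨h, (hadapt t _ _ fun s hs => ?_).mp ht.2⟩
            have : s ≠ i := by
              intro hsi
              rw [hsi] at hs
              have : l ≤ (t : ℕ) := hs
              omega
            simp [this]
          · right
            have hti : t = i := Fin.ext h
            rw [hti] at ht
            simp [ht.2, hti]
        refine (Finset.card_le_card hsub).trans ((Finset.card_union_le _ _).trans ?_)
        split_ifs <;> simp
      calc _ ≤ ∑ r : R, K ^ (Finset.univ.filter fun t : Fin T => (t : ℕ) < l ∧ bad t ω).card *
            (1 + if bad i (Function.update ω i r) then K else 0) := by
            refine Finset.sum_le_sum fun r _ => (Nat.pow_le_pow_right hK (e1 r)).trans ?_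
            rw [pow_add]
            refine Nat.mul_le_mul_left _ ?_
            split_ifs <;> simp
        _ ≤ _ := by
            rw [← Finset.mul_sum]
            refine Nat.mul_le_mul_left _ ?_
            rw [Finset.sum_add_distrib, ← Finset.sum_filter, Finset.sum_const, Finset.sum_const,
              smul_eq_mul, smul_eq_mul, Finset.card_univ]
            -- The sum of `1` over all `r` and the sum of `K` over the bad `r` are each at most
            -- `|R|`, which gives the factor `2 * |R|`.
            have := hprob i ω
            omega
    calc _ ≤ ∑ ω : Fin T → R, K ^ (Finset.univ.filter fun t : Fin T =>
            (t : ℕ) < l ∧ bad t ω).card * (2 * Fintype.card R) :=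
          Finset.sum_le_sum fun ω _ => step ω
      _ ≤ 2 ^ l * Fintype.card R ^ T * (2 * Fintype.card R) := by
          rw [← Finset.sum_mul]
          exact Nat.mul_le_mul_right _ ih'
      _ = _ := by ring

-- Markov's inequality for the moment bounded in `sum_pow_card_le`.
open Classical in
theorem card_many_bad_le {T : ℕ} (K : ℕ) (hK : 0 < K) (bad : Fin T → (Fin T → R) → Prop)
    (hadapt : ∀ t ω ω', (∀ s ≤ t, ω s = ω' s) → (bad t ω ↔ bad t ω'))
    (hprob : ∀ t ω, (Finset.univ.filter fun r => bad t (Function.update ω t r)).card * K ≤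
      Fintype.card R) (l : ℕ) (hl : l ≤ T) (m : ℕ) :
    (Finset.univ.filter fun ω : Fin T → R =>
        m ≤ (Finset.univ.filter fun t : Fin T => (t : ℕ) < l ∧ bad t ω).card).card * K ^ m ≤
      2 ^ l * Fintype.card R ^ T := by
  refine le_trans ?_ (sum_pow_card_le K hK bad hadapt hprob l hl)
  rw [← smul_eq_mul, ← Finset.sum_const]
  refine (Finset.sum_le_sum fun ω hω => ?_).trans
    (Finset.sum_le_sum_of_subset (Finset.filter_subset _ _))
  exact Nat.pow_le_pow_right hK (Finset.mem_filter.mp hω).2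

end Counting

/-! ### Tree codes -/

section TreeCode

/-- A causal code on infinite sequences of which two members agree on at most a `1 / h` fraction of
every interval of `[0, N)` that starts where the sequences first differ. -/
structure IsTreeCode {A F : Type*} (h N : ℕ) (enc : (ℕ → A) → ℕ → F) : Prop where
  causal : ∀ a a' j, (∀ i ≤ j, a i = a' i) → enc a j = enc a' j
  distance : ∀ a a' s j, s ≤ j → j < N → (∀ i < s, a i = a' i) → a s ≠ a' s →
    ∀ S : Finset ℕ, (∀ i ∈ S, s ≤ i ∧ i ≤ j ∧ enc a i = enc a' i) → h * S.card ≤ j + 1 - s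

/-- Extension of a finite sequence to `ℕ` by a default value. -/
def extend {R : Type*} [Inhabited R] {T : ℕ} (ω : Fin T → R) (t : ℕ) : R :=
  if h : t < T then ω ⟨t, h⟩ else default

theorem extend_eq {R : Type*} [Inhabited R] {T : ℕ} (ω : Fin T → R) (t : Fin T) :
    extend ω t = ω t := by
  simp [extend]

theorem extend_update {R : Type*} [Inhabited R] {T : ℕ} (ω : Fin T → R) (t : Fin T) (r : R) :
    extend (Function.update ω t r) = Function.update (extend ω) (t : ℕ) r := by
  classical
  funext s
  by_cases hs : s = t
  · subst hs
    rw [extend_eq]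
    simp
  · rw [Function.update_of_ne hs]
    unfold extend
    split_ifs with h
    · rw [Function.update_of_ne]
      intro h'
      exact hs (congrArg Fin.val h')
    · rfl

theorem sum_third_pow_lt (N : ℕ) : ∑ l ∈ Finset.range N, ((1 : ℝ) / 3) ^ (l + 1) < 1 := by
  have : ∑ l ∈ Finset.range N, ((1 : ℝ) / 3) ^ (l + 1) = (1 - (1 / 3) ^ N) / 2 := by
    induction N with
    | zero => simp
    | succ n ih => rw [Finset.sum_range_succ, ih]; ring
  rw [this]
  have : (0 : ℝ) < (1 / 3) ^ N := by positivity
  linarith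

/-- The convolution of two sequences. -/
def convolve {F : Type*} [Field F] (α d : ℕ → F) (j : ℕ) : F :=
  ∑ i ∈ Finset.range (j + 1), α (j - i) * d i

-- The coefficient `α t` enters the convolution at time `t` with factor `d 0`. If this is nonzero,
-- then exactly one value of `α t` makes the convolution vanish, whatever the earlier coefficients
-- are. Putting `d 0 ≠ 0` into the event keeps the conditional bound valid without a hypothesis on
-- `d`.
open Classical in
theorem card_convolve_zero_le {F : Type*} [Field F] [Fintype F] [Inhabited F] {N : ℕ} (d : ℕ → F)
    (l : ℕ) (hl : l ≤ N) (m : ℕ) :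
    (Finset.univ.filter fun ω : Fin N → F => m ≤ (Finset.univ.filter fun t : Fin N =>
        (t : ℕ) < l ∧ (d 0 ≠ 0 ∧ convolve (extend ω) d t = 0)).card).card * Fintype.card F ^ m ≤
      2 ^ l * Fintype.card F ^ N := by
  have hmain := card_many_bad_le (Fintype.card F) Fintype.card_pos
    (fun (t : Fin N) ω => d 0 ≠ 0 ∧ convolve (extend ω) d t = 0) ?_ ?_ l hl m
  · convert hmain
  · intro t ω ω' hω
    have : convolve (extend ω) d t = convolve (extend ω') d t := by
      refine Finset.sum_congr rfl fun i _ => ?_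
      congr 1
      have hlt : (t : ℕ) - i < N := lt_of_le_of_lt (Nat.sub_le _ _) t.2
      rw [extend, extend, dif_pos hlt, dif_pos hlt]
      exact hω _ (Fin.le_def.mpr (Nat.sub_le _ _))
    rw [this]
  · intro t ω
    refine (Nat.mul_le_mul_right _ ?_).trans (one_mul _).le
    rw [Finset.card_le_one]
    have hval : ∀ r, convolve (extend (Function.update ω t r)) d t =
        (∑ i ∈ Finset.range (t : ℕ), extend ω ((t : ℕ) - (i + 1)) * d (i + 1)) + r * d 0 := by
      intro r
      rw [convolve, Finset.sum_range_succ', extend_update]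
      congr 1
      · refine Finset.sum_congr rfl fun i hi => ?_
        rw [Function.update_of_ne]
        have := Finset.mem_range.mp hi
        omega
      · simp
    intro r hr r' hr'
    simp only [Finset.mem_filter, Finset.mem_univ, true_and, hval] at hr hr'
    have := hr.2.trans hr'.2.symm
    exact mul_right_cancel₀ hr.1 (add_left_cancel this)

/-- A union bound over random coefficients. The pairs of words of length `l + 1` number `(|A| ^ 2) ^
(l + 1)`. In the base `6 * |A| ^ 2`, one factor `2` absorbs the moment bound, and the factor `3`
leaves the summable series `3 ^ (-(l + 1))`, whose sum is below `1`. -/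
theorem exists_convolution_code {A F : Type*} [Fintype A] [Field F] [Fintype F] (v : A → F)
    (h : ℕ) (hh : 0 < h) (hF : (6 * Fintype.card A ^ 2) ^ h ≤ Fintype.card F)
    (hA : 0 < Fintype.card A) (N : ℕ) :
    ∃ α : ℕ → F, ∀ l < N, ∀ p : Fin (l + 1) → A × A, v (p 0).1 ≠ v (p 0).2 →
      ∀ S : Finset ℕ, (∀ t ∈ S, t < l + 1 ∧ convolve α (fun i =>
        if hi : i < l + 1 then v (p ⟨i, hi⟩).1 - v (p ⟨i, hi⟩).2 else 0) t = 0) →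
      h * S.card ≤ l + 1 := by
  classical
  let _ : Inhabited F := ⟨0⟩
  set dd : ∀ l : ℕ, (Fin (l + 1) → A × A) → ℕ → F := fun l p i =>
    if hi : i < l + 1 then v (p ⟨i, hi⟩).1 - v (p ⟨i, hi⟩).2 else 0 with hdd
  set Bad : ∀ l : ℕ, (Fin (l + 1) → A × A) → Finset (Fin N → F) := fun l p =>
    Finset.univ.filter fun ω : Fin N → F => (l + 1) / h + 1 ≤ (Finset.univ.filter fun t : Fin N =>
        (t : ℕ) < l + 1 ∧ (dd l p 0 ≠ 0 ∧ convolve (extend ω) (dd l p) t = 0)).card with hBad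
  set c := Fintype.card A with hc
  set q := Fintype.card F with hq
  have hq0 : 0 < q := Fintype.card_pos
  have hB : ∀ l < N, ∀ p, (Bad l p).card * (3 * c ^ 2) ^ (l + 1) ≤ q ^ N := by
    intro l hl p
    have h1 := card_convolve_zero_le (dd l p) (l + 1) hl ((l + 1) / h + 1)
    -- Violating the bound takes `(l + 1) / h + 1` zeros, and `h` times this number exceeds `l + 1`.
    have h2 : (6 * c ^ 2) ^ (l + 1) ≤ q ^ ((l + 1) / h + 1) := by
      calc (6 * c ^ 2) ^ (l + 1) ≤ (6 * c ^ 2) ^ (h * ((l + 1) / h + 1)) :=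
            Nat.pow_le_pow_right (by positivity) (by
              have := Nat.lt_mul_div_succ (l + 1) hh
              omega)
        _ = ((6 * c ^ 2) ^ h) ^ ((l + 1) / h + 1) := by rw [pow_mul]
        _ ≤ _ := Nat.pow_le_pow_left hF _
    refine Nat.le_of_mul_le_mul_left ?_ (show 0 < 2 ^ (l + 1) by positivity)
    calc 2 ^ (l + 1) * ((Bad l p).card * (3 * c ^ 2) ^ (l + 1))
        = (Bad l p).card * (6 * c ^ 2) ^ (l + 1) := by
          rw [show 6 * c ^ 2 = 2 * (3 * c ^ 2) by ring, mul_pow 2]; ring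
      _ ≤ (Bad l p).card * q ^ ((l + 1) / h + 1) := Nat.mul_le_mul_left _ h2
      _ ≤ _ := h1
  have hUl : ∀ l < N, (((Finset.univ.biUnion (Bad l)).card : ℕ) : ℝ) ≤
      (q : ℝ) ^ N * (1 / 3) ^ (l + 1) := by
    intro l hl
    have h1 : (Finset.univ.biUnion (Bad l)).card * 3 ^ (l + 1) ≤ q ^ N := by
      refine Nat.le_of_mul_le_mul_left ?_ (show 0 < (c ^ 2) ^ (l + 1) by positivity)
      calc (c ^ 2) ^ (l + 1) * ((Finset.univ.biUnion (Bad l)).card * 3 ^ (l + 1))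
          = (Finset.univ.biUnion (Bad l)).card * (3 * c ^ 2) ^ (l + 1) := by
            rw [mul_pow 3]; ring
        _ ≤ (∑ p, (Bad l p).card) * (3 * c ^ 2) ^ (l + 1) :=
            Nat.mul_le_mul_right _ Finset.card_biUnion_le
        _ = ∑ p, (Bad l p).card * (3 * c ^ 2) ^ (l + 1) := Finset.sum_mul _ _ _
        _ ≤ ∑ _p : Fin (l + 1) → A × A, q ^ N := Finset.sum_le_sum fun p _ => hB l hl p
        _ = (c ^ 2) ^ (l + 1) * q ^ N := by
            simp [Finset.card_univ, Fintype.card_prod, hc]; left; ring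
    have h2 : (((Finset.univ.biUnion (Bad l)).card : ℕ) : ℝ) * 3 ^ (l + 1) ≤ (q : ℝ) ^ N := by
      exact_mod_cast h1
    rw [one_div, inv_pow, ← div_eq_mul_inv, le_div_iff₀ (by positivity)]
    exact h2
  have hU : ((Finset.range N).biUnion fun l => Finset.univ.biUnion (Bad l)).card <
      (Finset.univ : Finset (Fin N → F)).card := by
    have hreal : ((((Finset.range N).biUnion fun l => Finset.univ.biUnion (Bad l)).card : ℕ) : ℝ) <
        (q : ℝ) ^ N := by
      calc ((((Finset.range N).biUnion fun l => Finset.univ.biUnion (Bad l)).card : ℕ) : ℝ)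
          ≤ ((∑ l ∈ Finset.range N, (Finset.univ.biUnion (Bad l)).card : ℕ) : ℝ) := by
            exact_mod_cast Finset.card_biUnion_le
        _ = ∑ l ∈ Finset.range N, (((Finset.univ.biUnion (Bad l)).card : ℕ) : ℝ) := by
            push_cast; rfl
        _ ≤ ∑ l ∈ Finset.range N, (q : ℝ) ^ N * (1 / 3) ^ (l + 1) :=
            Finset.sum_le_sum fun l hl => hUl l (Finset.mem_range.mp hl)
        _ = (q : ℝ) ^ N * ∑ l ∈ Finset.range N, (1 / 3) ^ (l + 1) := by rw [Finset.mul_sum]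
        _ < (q : ℝ) ^ N * 1 := by
            have := sum_third_pow_lt N
            gcongr
        _ = _ := mul_one _
    have hcard : (Finset.univ : Finset (Fin N → F)).card = q ^ N := by
      simp [Finset.card_univ, hq]
    rw [hcard]
    exact_mod_cast hreal
  obtain ⟨ω, -, hω⟩ := Finset.exists_mem_notMem_of_card_lt_card hU
  refine ⟨extend ω, fun l hl p hp S hS => ?_⟩
  have hnot : ω ∉ Bad l p := fun hmem => hω (Finset.mem_biUnion.mpr
    ⟨l, Finset.mem_range.mpr hl, Finset.mem_biUnion.mpr ⟨p, Finset.mem_univ _, hmem⟩⟩)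
  simp only [hBad, Finset.mem_filter, Finset.mem_univ, true_and, not_le] at hnot
  have hle : S.card ≤ (Finset.univ.filter fun t : Fin N =>
        (t : ℕ) < l + 1 ∧ (dd l p 0 ≠ 0 ∧ convolve (extend ω) (dd l p) t = 0)).card := by
    rw [← Finset.card_map Fin.valEmbedding]
    refine Finset.card_le_card fun t ht => ?_
    obtain ⟨h1, h2⟩ := hS t ht
    simp only [Finset.mem_map, Finset.mem_filter, Finset.mem_univ, true_and]
    refine ⟨⟨t, by omega⟩, ⟨h1, ?_, h2⟩, rfl⟩
    simp only [hdd]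
    rw [dif_pos (Nat.succ_pos l)]
    exact sub_ne_zero.mpr hp
  have h3 : S.card ≤ (l + 1) / h := by omega
  calc h * S.card ≤ h * ((l + 1) / h) := Nat.mul_le_mul_left _ h3
    _ ≤ l + 1 := Nat.mul_div_le _ _

/-- The code is convolution over a prime field whose size is fixed before `N`. By linearity,
agreements of two codewords are zeros of the convolution of the difference; the difference can be
shifted so that it starts at the first disagreement. -/
theorem exists_isTreeCode (A : Type*) [Fintype A] [Nonempty A] (h : ℕ) (hh : 0 < h) :
    ∃ q : ℕ, 0 < q ∧ ∀ N, ∃ enc : (ℕ → A) → ℕ → Fin q, IsTreeCode h N enc := by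
  classical
  obtain ⟨q, hq, hqp⟩ := Nat.exists_infinite_primes ((6 * Fintype.card A ^ 2) ^ h)
  have : Fact q.Prime := ⟨hqp⟩
  have hA : 0 < Fintype.card A := Fintype.card_pos
  have hcard : Fintype.card A ≤ Fintype.card (ZMod q) := by
    rw [ZMod.card]
    refine le_trans ?_ hq
    calc Fintype.card A ≤ 6 * Fintype.card A ^ 2 := by nlinarith
      _ ≤ _ := Nat.le_self_pow hh.ne' _
  obtain ⟨v⟩ := Function.Embedding.nonempty_of_card_le hcard
  have e : ZMod q ≃ Fin q := Fintype.equivOfCardEq (by simp [ZMod.card])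
  refine ⟨q, hqp.pos, fun N => ?_⟩
  obtain ⟨α, hα⟩ := exists_convolution_code v h hh (by rw [ZMod.card]; exact hq) hA N
  refine ⟨fun a j => e (convolve α (fun i => v (a i)) j), ?_, ?_⟩
  · intro a a' j hj
    congr 1
    refine Finset.sum_congr rfl fun i hi => ?_
    simp only [hj i (Nat.lt_succ_iff.mp (Finset.mem_range.mp hi))]
  · intro a a' s j hsj hj hlt hne S hS
    have := hα (j - s) (by omega) (fun i => (a (s + i), a' (s + i)))
      (fun hv => hne (by simpa using v.injective hv)) (S.image fun i => i - s) ?_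
    · rw [Finset.card_image_of_injOn] at this
      · omega
      · intro i hi i' hi' hii
        have h1 := hS i hi
        have h2 := hS i' hi'
        have h3 : i - s = i' - s := hii
        omega
    · intro t ht
      obtain ⟨i, hi, rfl⟩ := Finset.mem_image.mp ht
      obtain ⟨h1, h2, h3⟩ := hS i hi
      refine ⟨by omega, ?_⟩
      have h4 := sub_eq_zero.mpr (e.injective h3)
      rw [convolve, convolve, ← Finset.sum_sub_distrib] at h4
      obtain ⟨t, rfl⟩ := Nat.exists_eq_add_of_le h1
      rw [add_assoc, Finset.sum_range_add, Finset.sum_eq_zero, zero_add] at h4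
      · rw [convolve, ← h4, Nat.add_sub_cancel_left]
        refine Finset.sum_congr rfl fun i hi => ?_
        have := Finset.mem_range.mp hi
        rw [dif_pos (by omega), mul_sub, Nat.add_sub_add_left]
      · intro i hi
        rw [hlt i (Finset.mem_range.mp hi), sub_self]

end TreeCode

/-! ### Maximum-agreement decoding with erasures and forgeries -/

section Decode

variable {A F : Type*} [Nonempty A]

open Classical in
/-- The number of received symbols up to time `i` that agree with the encoding of `w`. -/
noncomputable def agreement (enc : (ℕ → A) → ℕ → F) (acc : ℕ → Option F) (i : ℕ) (w : ℕ → A) : ℕ :=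
  ((Finset.range (i + 1)).filter fun j => acc j = some (enc w j)).card

/-- There may be infinitely many words, but the agreement is an integer bounded by `i + 1`, so the
supremum is attained. -/
theorem exists_max_agreement (enc : (ℕ → A) → ℕ → F) (acc : ℕ → Option F) (i : ℕ) :
    ∃ w, ∀ w', agreement enc acc i w' ≤ agreement enc acc i w := by
  classical
  have hbdd : BddAbove (Set.range (agreement enc acc i)) := by
    refine ⟨i + 1, ?_⟩
    rintro _ ⟨w, rfl⟩
    exact (Finset.card_filter_le _ _).trans (by simp)
  have hne : (Set.range (agreement enc acc i)).Nonempty := Set.range_nonempty _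
  obtain ⟨w, hw⟩ := Nat.sSup_mem hne hbdd
  exact ⟨w, fun w' => hw ▸ le_csSup hbdd ⟨w', rfl⟩⟩

/-- Maximum-agreement decoding of the symbols received up to time `i`. -/
noncomputable def decode (enc : (ℕ → A) → ℕ → F) (acc : ℕ → Option F) (i : ℕ) : ℕ → A :=
  (exists_max_agreement enc acc i).choose

theorem agreement_le_decode (enc : (ℕ → A) → ℕ → F) (acc : ℕ → Option F) (i : ℕ) (w : ℕ → A) :
    agreement enc acc i w ≤ agreement enc acc i (decode enc acc i) :=
  (exists_max_agreement enc acc i).choose_spec w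

theorem decode_congr (enc : (ℕ → A) → ℕ → F) (acc acc' : ℕ → Option F) (i : ℕ)
    (h : ∀ j ≤ i, acc j = acc' j) : decode enc acc i = decode enc acc' i := by
  have : agreement enc acc i = agreement enc acc' i := by
    funext w
    classical
    unfold agreement
    congr 1
    refine Finset.filter_congr fun j hj => ?_
    rw [h j (Nat.lt_succ_iff.mp (Finset.mem_range.mp hj))]
  unfold decode
  congr 1
  simp only [this]

open Classical in
/-- The times before `n` at which a symbol is received that is not the one encoded. -/
noncomputable def forgedTimes (enc : (ℕ → A) → ℕ → F) (acc : ℕ → Option F) (a : ℕ → A) (n : ℕ) :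
    Finset ℕ :=
  (Finset.range n).filter fun i => acc i ≠ none ∧ acc i ≠ some (enc a i)

open Classical in
/-- The times before `n` at which a symbol is received and the decoding is wrong somewhere. -/
noncomputable def misdecodedTimes (enc : (ℕ → A) → ℕ → F) (acc : ℕ → Option F) (a : ℕ → A)
    (n : ℕ) : Finset ℕ :=
  (Finset.range n).filter fun i => acc i ≠ none ∧ ∃ j ≤ i, decode enc acc i j ≠ a j

/-- Suppose the decoding `w` at the last time first differs from `a` at `s`. From `s` on, `w` agrees
with at least as many received symbols as `a` does, and each of its agreements is a forgery or a
coincidence of the two codewords. Hence the symbols received from `s` on number at most twice the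
forgeries there plus the coincidences, which the code bounds. All of these times are charged as
misdecoded, and induction handles the times before `s`. -/
theorem card_misdecoded_le {h N : ℕ} {enc : (ℕ → A) → ℕ → F} (henc : IsTreeCode h N enc)
    (acc : ℕ → Option F) (a : ℕ → A) (n : ℕ) (hn : n ≤ N) :
    h * (misdecodedTimes enc acc a n).card ≤ n + 2 * h * (forgedTimes enc acc a n).card := by
  classical
  induction n using Nat.strong_induction_on with
  | _ n ih =>
  rcases n with _ | n
  · simp [misdecodedTimes]
  by_cases hw : acc n ≠ none ∧ ∃ j ≤ n, decode enc acc n j ≠ a j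
  · obtain ⟨hacc, hex⟩ := hw
    set w := decode enc acc n with hwdef
    have hex' : ∃ j, j ≤ n ∧ w j ≠ a j := hex
    set s := Nat.find hex' with hs
    obtain ⟨hsn, hsne⟩ : s ≤ n ∧ w s ≠ a s := Nat.find_spec hex'
    have hlt : ∀ i < s, w i = a i := by
      intro i hi
      by_contra hne
      exact Nat.find_min hex' hi ⟨by omega, hne⟩
    set I := Finset.Ico s (n + 1) with hI
    set U := I.filter fun j => acc j ≠ none
    set Fo := I.filter fun j => acc j ≠ none ∧ acc j ≠ some (enc a j)
    set Ga := I.filter fun j => acc j = some (enc a j)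
    set Gw := I.filter fun j => acc j = some (enc w j)
    set E := I.filter fun j => enc w j = enc a j
    have hrange : Finset.range (n + 1) = Finset.range s ∪ I := by
      ext j; simp [hI]; omega
    have hdisj : Disjoint (Finset.range s) I := by
      rw [Finset.disjoint_left]; intro j; simp [hI]; omega
    have hagr : ∀ u, agreement enc acc n u =
        ((Finset.range s).filter fun j => acc j = some (enc u j)).card +
          (I.filter fun j => acc j = some (enc u j)).card := by
      intro u
      rw [agreement, hrange, Finset.filter_union, Finset.card_union_of_disjoint
        (Finset.disjoint_filter_filter hdisj)]
    -- Maximality concerns all times up to `n`. Before `s` both encodings coincide by causality, so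
    -- the comparison descends to `I`.
    have hmax : Ga.card ≤ Gw.card := by
      have h1 := agreement_le_decode enc acc n a
      rw [← hwdef, hagr, hagr] at h1
      have h2 : ((Finset.range s).filter fun j => acc j = some (enc w j)) =
          (Finset.range s).filter fun j => acc j = some (enc a j) := by
        refine Finset.filter_congr fun j hj => ?_
        rw [henc.causal w a j fun i hi => hlt i (lt_of_le_of_lt hi (Finset.mem_range.mp hj))]
      rw [h2] at h1
      exact Nat.le_of_add_le_add_left h1
    have hU : U.card ≤ Fo.card + Ga.card := by
      refine le_trans (Finset.card_le_card ?_) (Finset.card_union_le _ _)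
      intro j hj
      simp only [U, Fo, Ga, Finset.mem_filter, Finset.mem_union] at hj ⊢
      tauto
    have hGw : Gw.card ≤ Fo.card + E.card := by
      refine le_trans (Finset.card_le_card ?_) (Finset.card_union_le _ _)
      intro j hj
      simp only [Gw, Fo, E, Finset.mem_filter, Finset.mem_union] at hj ⊢
      by_cases he : enc w j = enc a j
      · exact Or.inr ⟨hj.1, he⟩
      · refine Or.inl ⟨hj.1, ?_, ?_⟩ <;> rw [hj.2] <;> simp [he]
    have hE : h * E.card ≤ n + 1 - s := by
      refine henc.distance w a s n hsn (by omega) hlt hsne E ?_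
      intro i hi
      simp only [E, hI, Finset.mem_filter, Finset.mem_Ico] at hi
      exact ⟨hi.1.1, by omega, hi.2⟩
    have hM : (misdecodedTimes enc acc a (n + 1)).card ≤
        (misdecodedTimes enc acc a s).card + U.card := by
      refine le_trans (Finset.card_le_card ?_) (Finset.card_union_le _ _)
      intro j hj
      simp only [misdecodedTimes, hrange, U, Finset.mem_filter, Finset.mem_union] at hj ⊢
      exact hj.1.imp (fun h1 => ⟨h1, hj.2⟩) fun h1 => ⟨h1, hj.2.1⟩
    have hF : (forgedTimes enc acc a (n + 1)).card =
        (forgedTimes enc acc a s).card + Fo.card := by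
      rw [forgedTimes, hrange, Finset.filter_union, Finset.card_union_of_disjoint
        (Finset.disjoint_filter_filter hdisj)]
      rfl
    have hih := ih s (by omega) (by omega)
    rw [hF]
    have h5 : U.card ≤ 2 * Fo.card + E.card := by omega
    calc h * (misdecodedTimes enc acc a (n + 1)).card
        ≤ h * ((misdecodedTimes enc acc a s).card + (2 * Fo.card + E.card)) :=
          Nat.mul_le_mul_left _ (hM.trans (Nat.add_le_add_left h5 _))
      _ = h * (misdecodedTimes enc acc a s).card + 2 * h * Fo.card + h * E.card := by ring
      _ ≤ (s + 2 * h * (forgedTimes enc acc a s).card) + 2 * h * Fo.card + (n + 1 - s) := by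
          gcongr
      _ = n + 1 + 2 * h * ((forgedTimes enc acc a s).card + Fo.card) := by
          rw [mul_add]; omega
  · have h1 : misdecodedTimes enc acc a (n + 1) = misdecodedTimes enc acc a n := by
      rw [misdecodedTimes, Finset.range_add_one, Finset.filter_insert, if_neg hw]
      rfl
    have h2 : (forgedTimes enc acc a n).card ≤ (forgedTimes enc acc a (n + 1)).card := by
      refine Finset.card_le_card (Finset.filter_subset_filter _ ?_)
      exact Finset.range_subset_range.mpr (Nat.le_succ n)
    have h3 := ih n (Nat.lt_succ_self n) (by omega)
    rw [h1]
    have h4 := Nat.mul_le_mul_left (2 * h) h2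
    omega

end Decode

/-! ### Walks on binary paths -/

section Walk

/-- Length of the longest common prefix. -/
def lcp : List Bool → List Bool → ℕ
  | a :: s, b :: t => if a = b then lcp s t + 1 else 0
  | _, _ => 0

theorem lcp_le_left : ∀ s t, lcp s t ≤ s.length
  | [], t => by simp [lcp]
  | a :: s, [] => by simp [lcp]
  | a :: s, b :: t => by
    have := lcp_le_left s t
    simp only [lcp, List.length_cons]
    split_ifs <;> omega

theorem lcp_comm : ∀ s t, lcp s t = lcp t s
  | [], [] => rfl
  | [], b :: t => by simp [lcp]
  | a :: s, [] => by simp [lcp]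
  | a :: s, b :: t => by
    simp only [lcp, lcp_comm s t, eq_comm]

theorem lcp_le_right (s t) : lcp s t ≤ t.length := lcp_comm s t ▸ lcp_le_left t s

theorem take_lcp : ∀ s t : List Bool, s.take (lcp s t) = t.take (lcp s t)
  | [], t => by simp [lcp]
  | a :: s, [] => by simp [lcp]
  | a :: s, b :: t => by
    simp only [lcp]
    split_ifs with h
    · simp [h, take_lcp s t]
    · simp

theorem le_lcp : ∀ {s t : List Bool} {i : ℕ}, i ≤ s.length → i ≤ t.length →
    s.take i = t.take i → i ≤ lcp s t
  | _, _, 0, _, _, _ => Nat.zero_le _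
  | [], _, i + 1, h, _, _ => by simp at h
  | _ :: _, [], i + 1, _, h, _ => by simp at h
  | a :: s, b :: t, i + 1, h, h', e => by
    simp only [List.take_succ_cons, List.cons.injEq] at e
    simp only [lcp, e.1, if_true]
    exact Nat.succ_le_succ (le_lcp (by simpa using h) (by simpa using h') e.2)

theorem take_eq_of_le_lcp {s t : List Bool} {i : ℕ} (h : i ≤ lcp s t) : s.take i = t.take i := by
  have := congrArg (List.take i) (take_lcp s t)
  rwa [List.take_take, List.take_take, min_eq_left h] at this

theorem getElem?_eq_of_lt_lcp {s t : List Bool} {i : ℕ} (h : i < lcp s t) : s[i]? = t[i]? := by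
  have := congrArg (fun l => l[i]?) (take_eq_of_le_lcp h)
  simpa [List.getElem?_take] using this

/-- An operation on a path: hold, remove the last step, or append a step. -/
abbrev Op := Option (Option Bool)

/-- Application of an operation to a path. -/
def applyOp : Op → List Bool → List Bool
  | none, T => T
  | some none, T => T.dropLast
  | some (some c), T => T ++ [c]

/-- Number of operations needed to get from `T` to `P`. -/
def pathDist (P T : List Bool) : ℕ := T.length + P.length - 2 * lcp T P

theorem lcp_append_ge (P T : List Bool) (c : Bool) : lcp T P ≤ lcp (T ++ [c]) P := by
  refine le_lcp ((lcp_le_left T P).trans (by simp)) (lcp_le_right _ _) ?_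
  rw [List.take_append_of_le_length (lcp_le_left _ _), take_lcp]

theorem le_lcp_dropLast {P T : List Bool} {i : ℕ} (hi : i ≤ lcp T P) (hi' : i ≤ T.length - 1) :
    i ≤ lcp T.dropLast P := by
  refine le_lcp (by simpa using hi') (hi.trans (lcp_le_right _ _)) ?_
  rw [List.dropLast_eq_take, List.take_take, min_eq_left hi', take_eq_of_le_lcp hi]

theorem pathDist_applyOp_le (P T : List Bool) (o : Op) :
    pathDist P (applyOp o T) ≤ pathDist P T + 1 := by
  have h1 := lcp_le_left T P
  have h2 := lcp_le_right T P
  rcases o with _ | _ | c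
  · simp [applyOp]
  · have h3 := @le_lcp_dropLast P T (min (lcp T P) (T.length - 1)) (min_le_left _ _)
      (min_le_right _ _)
    have h4 : T.dropLast.length = T.length - 1 := List.length_dropLast
    simp only [pathDist, applyOp]
    omega
  · have h3 := lcp_append_ge P T c
    have h4 : (T ++ [c]).length = T.length + 1 := by simp
    simp only [pathDist, applyOp]
    omega

theorem pathDist_dropLast_lt {P T : List Bool} (h : lcp T P < T.length) :
    pathDist P T.dropLast + 1 ≤ pathDist P T := by
  have h3 := @le_lcp_dropLast P T (lcp T P) le_rfl (by omega)
  have h4 : T.dropLast.length = T.length - 1 := List.length_dropLast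
  have h2 := lcp_le_right T P
  simp only [pathDist]
  omega

theorem pathDist_append_lt {P T : List Bool} {c : Bool} (h : T = P.take T.length)
    (hc : P[T.length]? = some c) : pathDist P (T ++ [c]) + 1 ≤ pathDist P T := by
  have hlt : T.length < P.length := (List.getElem?_eq_some_iff.mp hc).1
  have h3 : T.length + 1 ≤ lcp (T ++ [c]) P := by
    refine le_lcp (by simp) hlt ?_
    rw [List.take_of_length_le (by simp), List.take_add_one, ← h, hc]
    rfl
  have h4 : (T ++ [c]).length = T.length + 1 := by simp
  have h1 := lcp_le_left T P
  simp only [pathDist]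
  omega

/-- Operation of a party at position `T` that believes the other party to be at `S`. It owns the
nodes `v` with `mine v` and takes step `bit v` there; positions have length at most `D`. -/
def move (D : ℕ) (mine bit : List Bool → Bool) (T S : List Bool) : Op :=
  if lcp T S = T.length then
    if D ≤ T.length then none
    else if mine T then some (some (bit T)) else (S[T.length]?).map some
  else if lcp T S < S.length ∧ mine (T.take (lcp T S)) = false then some none else none

/-- Every step of the path out of a node with `mine` is the one given by `bit`. -/
def Follows (mine bit : List Bool → Bool) (T : List Bool) : Prop :=
  ∀ i < T.length, mine (T.take i) = true → T[i]? = some (bit (T.take i))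

theorem follows_nil (mine bit) : Follows mine bit [] := fun i hi => by simp at hi

theorem Follows.dropLast {mine bit T} (h : Follows mine bit T) : Follows mine bit T.dropLast := by
  intro i hi hm
  rw [List.length_dropLast] at hi
  rw [List.dropLast_eq_take, List.take_take, min_eq_left hi.le] at hm ⊢
  rw [List.getElem?_take, if_pos hi]
  exact h i (by omega) hm

theorem Follows.append {mine bit T} (h : Follows mine bit T) {c : Bool}
    (hc : mine T = true → c = bit T) : Follows mine bit (T ++ [c]) := by
  intro i hi hm
  have hi' : i < T.length + 1 := by simpa using hi
  rcases Nat.lt_succ_iff_lt_or_eq.mp hi' with hlt | rfl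
  · rw [List.take_append_of_le_length hlt.le] at hm ⊢
    rw [List.getElem?_append_left hlt]
    exact h i hlt hm
  · rw [List.take_left] at hm ⊢
    simp [hc hm]

theorem Follows.applyOp_move {mine bit T} (h : Follows mine bit T) (D : ℕ) (S : List Bool) :
    Follows mine bit (applyOp (move D mine bit T S) T) := by
  unfold move
  split_ifs with h1 h2 h3 h4
  · exact h
  · exact h.append fun _ => rfl
  · rcases hS : S[T.length]? with _ | c
    · exact h
    · exact h.append fun hm => absurd hm h3
  · exact h.dropLast
  · exact h

theorem length_applyOp_move {D : ℕ} {mine bit T} (h : T.length ≤ D) (S : List Bool) :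
    (applyOp (move D mine bit T S) T).length ≤ D := by
  unfold move
  split_ifs with h1 h2 h3 h4
  · exact h
  · simp only [applyOp, List.length_append, List.length_singleton]; omega
  · rcases hS : S[T.length]? with _ | c
    · exact h
    · simp only [Option.map, applyOp, List.length_append, List.length_singleton]; omega
  · simp only [applyOp, List.length_dropLast]; omega
  · exact h

/-- The two parties' steps agree with those of `P`, and each node is owned by one party. -/
structure IsTarget (m b m' b' : List Bool → Bool) (P : List Bool) : Prop where
  owner : ∀ v, m' v = !m v
  left : Follows m b P
  right : Follows m' b' P

theorem IsTarget.symm {m b m' b' P} (h : IsTarget m b m' b' P) : IsTarget m' b' m b P :=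
  ⟨fun v => by simp [h.owner v], h.right, h.left⟩

variable {m b m' b' : List Bool → Bool} {P T S : List Bool}

/-- At each node of a common prefix, the owner's own path takes the owner's step there, which is
also the step of `P`. -/
theorem IsTarget.take_eq (hP : IsTarget m b m' b' P) (hT : Follows m b T) (hS : Follows m' b' S) :
    ∀ i, i ≤ lcp T S → i ≤ P.length → T.take i = P.take i := by
  intro i
  induction i with
  | zero => simp
  | succ i ih =>
    intro h1 h2
    have e := ih (by omega) (by omega)
    have hTl := lcp_le_left T S
    have hSl := lcp_le_right T S
    have key : T[i]? = P[i]? := by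
      cases hm : m (T.take i) with
      | true => rw [hT i (by omega) hm, hP.left i (by omega) (e ▸ hm), e]
      | false =>
        have hm' : m' (T.take i) = true := by rw [hP.owner, hm]; rfl
        have e' : T.take i = S.take i := take_eq_of_le_lcp (by omega)
        rw [getElem?_eq_of_lt_lcp h1, hS i (by omega) (e' ▸ hm'), hP.right i (by omega) (e ▸ hm'),
          ← e', e]
    rw [List.take_add_one, List.take_add_one, e, key]

/-- Whether a correct move of the party at `T` is not a hold. -/
def Active (D : ℕ) (m : List Bool → Bool) (T S : List Bool) : Prop :=
  (lcp T S = T.length ∧ T.length < D ∧ (m T = true ∨ T.length < S.length)) ∨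
    (lcp T S < T.length ∧ lcp T S < S.length ∧ m (T.take (lcp T S)) = false)

theorem move_of_not_active (D : ℕ) (h : ¬ Active D m T S) : move D m b T S = none := by
  unfold Active at h
  push Not at h
  unfold move
  split_ifs with h1 h2 h3 h4
  · rfl
  · exact absurd h3 (h.1 h1 (by omega)).1
  · have := (h.1 h1 (by omega)).2
    rw [List.getElem?_eq_none this]
    rfl
  · exact absurd h4.2 (h.2 (lt_of_le_of_ne (lcp_le_left _ _) h1) h4.1)
  · rfl

/-- A party extends only along a common prefix, which lies on the target, and the added step comes
from the owner of the node. It retracts only if the paths diverge at a node of the other party;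
there the other's step is right and its own is wrong. -/
theorem pathDist_move_lt (hP : IsTarget m b m' b' P) (hT : Follows m b T) (hS : Follows m' b' S)
    (hl : T.length ≤ P.length) (h : Active P.length m T S) :
    pathDist P (applyOp (move P.length m b T S) T) + 1 ≤ pathDist P T := by
  have htake := hP.take_eq hT hS
  rcases h with ⟨h1, h2, h3⟩ | ⟨h1, h2, h3⟩
  · have e : T = P.take T.length := by
      have := htake T.length h1.ge hl
      rwa [List.take_length] at this
    cases hm : m T with
    | true =>
      have : move P.length m b T S = some (some (b T)) := by
        simp [move, h1, hm, h2]
      rw [this]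
      refine pathDist_append_lt e ?_
      rw [hP.left _ h2 (e ▸ hm), ← e]
    | false =>
      have h4 : T.length < S.length := by simpa [hm] using h3
      have hm' : m' T = true := by rw [hP.owner, hm]; rfl
      have e' : T = S.take T.length := by
        have := take_eq_of_le_lcp h1.ge
        rwa [List.take_length] at this
      have hc := hS _ h4 (e' ▸ hm')
      rw [← e'] at hc
      have : move P.length m b T S = some (some (b' T)) := by
        simp [move, h1, hm, h2, hc]
      rw [this]
      refine pathDist_append_lt e ?_
      rw [hP.right _ h2 (e ▸ hm'), ← e]
  · have : move P.length m b T S = some none := by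
      simp [move, h1.ne, h2, h3]
    rw [this]
    refine pathDist_dropLast_lt ?_
    -- If all of `T` were on the target, then `T` and `S` would both leave the point of divergence
    -- by the step of `P`, so their common prefix would be longer.
    by_contra hcon
    have e := htake (lcp T S) le_rfl (by omega)
    have e' := take_lcp T S
    have hm' : m' (T.take (lcp T S)) = true := by rw [hP.owner, h3]; rfl
    have hPS : P[lcp T S]? = S[lcp T S]? := by
      rw [hP.right _ (by omega) (e ▸ hm'), hS _ h2 (e' ▸ hm'), ← e, ← e']
    have hTP : T[lcp T S]? = P[lcp T S]? := getElem?_eq_of_lt_lcp (by omega)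
    have : lcp T S + 1 ≤ lcp T S := by
      refine le_lcp h1 h2 ?_
      rw [List.take_add_one, List.take_add_one, e', hTP, hPS]
    omega

theorem pathDist_move_le (hP : IsTarget m b m' b' P) (hT : Follows m b T) (hS : Follows m' b' S)
    (hl : T.length ≤ P.length) :
    pathDist P (applyOp (move P.length m b T S) T) ≤ pathDist P T := by
  by_cases h : Active P.length m T S
  · have := pathDist_move_lt hP hT hS hl h
    omega
  · rw [move_of_not_active _ h]
    rfl

/-- If both parties move in turn with correct beliefs, then they get closer to the target. -/
theorem pathDist_move_move (hP : IsTarget m b m' b' P) (hT : Follows m b T) (hS : Follows m' b' S)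
    (hTl : T.length ≤ P.length) (hSl : S.length ≤ P.length) {S' : List Bool}
    (hS' : S' = applyOp (move P.length m' b' S T) S) :
    pathDist P (applyOp (move P.length m b T S') T) + pathDist P S' ≤
      pathDist P T + pathDist P S - 1 := by
  have hFS' : Follows m' b' S' := hS' ▸ hS.applyOp_move _ _
  have hA := pathDist_move_le hP hT hFS' hTl
  by_cases hact : Active P.length m' S T
  · have h1 := pathDist_move_lt hP.symm hS hT hSl hact
    rw [← hS'] at h1
    omega
  · have hSS : S' = S := by rw [hS', move_of_not_active _ hact]; rfl
    rw [hSS] at hA ⊢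
    by_cases hz : pathDist P T + pathDist P S = 0
    · omega
    have hactA : Active P.length m T S := by
      unfold Active at hact ⊢
      push Not at hact
      have h1 := lcp_le_left T S
      have h2 := lcp_le_right T S
      rw [lcp_comm S T] at hact
      rcases eq_or_lt_of_le h2 with h2 | h2
      · rcases eq_or_lt_of_le hSl with h3 | h3
        · exfalso
          have h4 : T.length = P.length := by omega
          have e1 := hP.take_eq hT hS P.length (by omega) le_rfl
          have e2 : S.take P.length = T.take P.length := (take_eq_of_le_lcp (by omega)).symm
          have e3 : T = P := by
            rwa [List.take_of_length_le h4.le, List.take_of_length_le le_rfl] at e1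
          have e4 : S = P := by
            rwa [List.take_of_length_le h3.le, List.take_of_length_le h4.le, e3] at e2
          refine hz ?_
          have h5 : P.length ≤ lcp P P := le_lcp le_rfl le_rfl rfl
          rw [e3, e4, pathDist]
          omega
        · have h4 := hact.1 h2 h3
          have h5 : lcp T S = T.length := by omega
          refine Or.inl ⟨h5, by omega, Or.inl ?_⟩
          have h6 : T = S := by
            have := take_lcp T S
            rwa [List.take_of_length_le (by omega), List.take_of_length_le (by omega)] at this
          have h7 := h4.1
          rw [hP.owner, ← h6] at h7
          simpa using h7
      · rcases eq_or_lt_of_le h1 with h3 | h3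
        · exact Or.inl ⟨h3, by omega, Or.inr (by omega)⟩
        · refine Or.inr ⟨h3, h2, ?_⟩
          have h4 := hact.2 h2 h3
          rw [← take_lcp, hP.owner] at h4
          simpa using h4
    have h1 := pathDist_move_lt hP hT hS hTl hactA
    omega

/-- The path that takes at each node the step of its owner. -/
def targetPath (m b b' : List Bool → Bool) : ℕ → List Bool
  | 0 => []
  | n + 1 => targetPath m b b' n ++
      [if m (targetPath m b b' n) then b (targetPath m b b' n) else b' (targetPath m b b' n)]

theorem length_targetPath (n : ℕ) : (targetPath m b b' n).length = n := by
  induction n with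
  | zero => rfl
  | succ n ih => simp [targetPath, ih]

theorem take_targetPath {i n : ℕ} (h : i ≤ n) :
    (targetPath m b b' n).take i = targetPath m b b' i := by
  induction n with
  | zero => rw [Nat.le_zero.mp h]; rfl
  | succ n ih =>
    rcases Nat.le_succ_iff.mp h with h | rfl
    · rw [targetPath, List.take_append_of_le_length (by rwa [length_targetPath]), ih h]
    · exact List.take_of_length_le (length_targetPath _).le

theorem isTarget_targetPath (h : ∀ v, m' v = !m v) (n : ℕ) :
    IsTarget m b m' b' (targetPath m b b' n) := by
  refine ⟨h, ?_, ?_⟩ <;> induction n with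
  | zero => exact follows_nil _ _
  | succ n ih => exact ih.append fun hm => by simp_all

end Walk

/-! ### Protocol trees as infinite binary trees -/

section Trees

variable {X Y Z : Type*}

namespace ProtocolTree

/-- The subtree at the end of a path; leaves extend forever. -/
def subtree : ProtocolTree X Y Z → List Bool → ProtocolTree X Y Z
  | t, [] => t
  | leaf z, _ :: _ => leaf z
  | alice _ t₀ t₁, c :: l => if c then t₁.subtree l else t₀.subtree l
  | bob _ t₀ t₁, c :: l => if c then t₁.subtree l else t₀.subtree l

theorem subtree_nil (t : ProtocolTree X Y Z) : t.subtree [] = t := by cases t <;> rfl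

theorem subtree_leaf (z : Z) (l : List Bool) :
    (leaf z : ProtocolTree X Y Z).subtree l = leaf z := by cases l <;> rfl

theorem subtree_append (t : ProtocolTree X Y Z) (l l' : List Bool) :
    t.subtree (l ++ l') = (t.subtree l).subtree l' := by
  induction l generalizing t with
  | nil => rw [subtree_nil]; rfl
  | cons c l ih =>
    cases t with
    | leaf z => rw [subtree_leaf, subtree_leaf, subtree_leaf]
    | alice b t₀ t₁ => cases c <;> simp [subtree, ih]
    | bob b t₀ t₁ => cases c <;> simp [subtree, ih]

/-- Whether Alice owns the root; she also owns the leaves. -/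
def rootAlice : ProtocolTree X Y Z → Bool
  | bob _ _ _ => false
  | _ => true

/-- The bit that Alice sends at the root. -/
def rootBitA (x : X) : ProtocolTree X Y Z → Bool
  | alice bit _ _ => bit x
  | _ => false

/-- The bit that Bob sends at the root. -/
def rootBitB (y : Y) : ProtocolTree X Y Z → Bool
  | bob bit _ _ => bit y
  | _ => false

/-- The output at the root if this is a leaf, and otherwise a default value. -/
def rootOut (z₀ : Z) : ProtocolTree X Y Z → Z
  | leaf z => z
  | _ => z₀

/-- The path of the tree on inputs `x`, `y`, prolonged to length `n`. -/
def inputPath (t : ProtocolTree X Y Z) (x : X) (y : Y) (n : ℕ) : List Bool :=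
  targetPath (fun v => (t.subtree v).rootAlice) (fun v => (t.subtree v).rootBitA x)
    (fun v => (t.subtree v).rootBitB y) n

theorem subtree_inputPath (t : ProtocolTree X Y Z) (x : X) (y : Y) (n : ℕ) :
    (t.subtree (t.inputPath x y n)).eval x y = t.eval x y ∧
      (t.subtree (t.inputPath x y n)).depth ≤ t.depth - n := by
  induction n with
  | zero => simp [inputPath, targetPath, subtree_nil]
  | succ n ih =>
    rw [inputPath, targetPath, subtree_append]
    rw [inputPath] at ih
    generalize targetPath _ _ _ n = l at ih ⊢
    obtain ⟨h1, h2⟩ := ih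
    rw [← h1]
    cases ht : t.subtree l with
    | leaf z => simp [subtree, depth]
    | alice bit t₀ t₁ =>
      rw [ht, depth] at h2
      cases hb : bit x <;>
        simp only [rootAlice, rootBitA, hb, subtree, subtree_nil, eval, if_true] <;>
        simp <;> omega
    | bob bit t₀ t₁ =>
      rw [ht, depth] at h2
      cases hb : bit y <;>
        simp only [rootAlice, rootBitB, hb, subtree, subtree_nil, eval, if_true] <;>
        simp <;> omega

/-- After `t.depth` correct steps a leaf is reached, and any further steps, even wrong ones, stay at
it. -/
theorem rootOut_subtree (t : ProtocolTree X Y Z) (x : X) (y : Y) (z₀ : Z) {D : ℕ}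
    {T : List Bool} (hT : t.depth ≤ lcp T (t.inputPath x y D)) :
    (t.subtree T).rootOut z₀ = t.eval x y := by
  have hD : t.depth ≤ D := by
    have := hT.trans (lcp_le_right _ _)
    rwa [inputPath, length_targetPath] at this
  have h1 : T.take t.depth = t.inputPath x y t.depth := by
    rw [take_eq_of_le_lcp hT, inputPath, take_targetPath hD]
    rfl
  obtain ⟨h2, h3⟩ := t.subtree_inputPath x y t.depth
  rw [← List.take_append_drop t.depth T, subtree_append, h1]
  cases ht : t.subtree (t.inputPath x y t.depth) with
  | leaf z =>
    rw [subtree_leaf, ← h2, ht]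
    rfl
  | alice bit t₀ t₁ => rw [ht, depth] at h3; omega
  | bob bit t₀ t₁ => rw [ht, depth] at h3; omega

end ProtocolTree

end Trees

/-! ### Simulation of a path against erasures and forgeries -/

section Simulation

/-- The path after the first operations of a strategy. -/
def walk (op : ℕ → List Bool → Op) : ℕ → List Bool
  | 0 => []
  | i + 1 => applyOp (op i (walk op i)) (walk op i)

/-- The operations that a strategy performs. -/
def opStream (op : ℕ → List Bool → Op) (i : ℕ) : Op := op i (walk op i)

theorem walk_congr {op op' : ℕ → List Bool → Op} {n : ℕ} (h : ∀ i < n, op i = op' i) :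
    walk op n = walk op' n := by
  induction n with
  | zero => rfl
  | succ n ih => rw [walk, walk, ih fun i hi => h i (by omega), h n (by omega)]

theorem opStream_congr {op op' : ℕ → List Bool → Op} {n : ℕ} (h : ∀ i ≤ n, op i = op' i) :
    opStream op n = opStream op' n := by
  rw [opStream, opStream, walk_congr fun i hi => h i (by omega), h n le_rfl]

/-- Positions are functions of the operations alone, so decoding a party's operations recovers its
position. -/
theorem walk_of_opStream {op : ℕ → List Bool → Op} {w : ℕ → Op} {n : ℕ}
    (h : ∀ i < n, w i = opStream op i) : walk (fun i _ => w i) n = walk op n := by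
  induction n with
  | zero => rfl
  | succ n ih => rw [walk, walk, ih fun i hi => h i (by omega), h n (by omega), opStream]

/-- The strategy one time step later. -/
def delay (op : ℕ → List Bool → Op) : ℕ → List Bool → Op
  | 0, _ => none
  | i + 1, T => op i T

variable {F : Type*}

open Classical in
/-- The strategy of a party: hold if nothing is accepted, and otherwise move according to the
decoded operations of the other party. -/
noncomputable def react (enc : (ℕ → Op) → ℕ → F) (D : ℕ) (m b : List Bool → Bool)
    (acc : ℕ → Option F) (i : ℕ) (T : List Bool) : Op :=
  if acc i = none then none
  else move D m b T (walk (fun j _ => decode enc acc i j) (i + 1))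

variable {enc : (ℕ → Op) → ℕ → F} {D : ℕ} {m b : List Bool → Bool} {acc acc' : ℕ → Option F}

theorem react_congr {i : ℕ} (h : ∀ j ≤ i, acc j = acc' j) :
    react enc D m b acc i = react enc D m b acc' i := by
  funext T
  rw [react, react, decode_congr enc acc acc' i h, h i le_rfl]

theorem delay_react_congr {i : ℕ} (h : ∀ j < i, acc j = acc' j) :
    delay (react enc D m b acc) i = delay (react enc D m b acc') i := by
  cases i with
  | zero => rfl
  | succ i =>
    funext T
    simp only [delay]
    rw [react_congr fun j hj => h j (Nat.lt_succ_of_le hj)]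

theorem invariant_walk {op : ℕ → List Bool → Op} {D : ℕ} {m b : List Bool → Bool}
    (h : ∀ i T, op i T = none ∨ ∃ S, op i T = move D m b T S) (n : ℕ) :
    Follows m b (walk op n) ∧ (walk op n).length ≤ D := by
  induction n with
  | zero => exact ⟨follows_nil _ _, Nat.zero_le _⟩
  | succ n ih =>
    rw [walk]
    rcases h n (walk op n) with h | ⟨S, h⟩ <;> rw [h]
    · exact ih
    · exact ⟨ih.1.applyOp_move _ _, length_applyOp_move ih.2 _⟩

theorem react_eq (i : ℕ) (T : List Bool) :
    react enc D m b acc i T = none ∨ ∃ S, react enc D m b acc i T = move D m b T S := by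
  unfold react
  split_ifs
  · exact Or.inl rfl
  · exact Or.inr ⟨_, rfl⟩

theorem delay_react_eq (i : ℕ) (T : List Bool) :
    delay (react enc D m b acc) i T = none ∨
      ∃ S, delay (react enc D m b acc) i T = move D m b T S := by
  cases i with
  | zero => exact Or.inl rfl
  | succ i => exact react_eq i T

theorem react_of_decoded {op : ℕ → List Bool → Op} {i : ℕ} {T : List Bool} (ha : acc i ≠ none)
    (h : ∀ j ≤ i, decode enc acc i j = opStream op j) :
    react enc D m b acc i T = move D m b T (walk op (i + 1)) := by
  rw [react, if_neg ha, walk_of_opStream fun j hj => h j (Nat.lt_succ_iff.mp hj)]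

theorem card_filter_range_succ (p : ℕ → Prop) [DecidablePred p] (n : ℕ) :
    ((Finset.range (n + 1)).filter p).card =
      ((Finset.range n).filter p).card + if p n then 1 else 0 := by
  rw [Finset.card_filter, Finset.card_filter, Finset.sum_range_succ]

variable {m' b' : List Bool → Bool} {P : List Bool} {accA accB : ℕ → Option F}

-- The times are staggered: in iteration `n` Bob reacts to Alice's position at `n + 1`, and Alice
-- then reacts to Bob's new position at `n + 1`. A bad iteration adds at most two to the total
-- distance. Any other iteration adds nothing, and it removes one (if the total is positive) when
-- both parties accept.
open Classical in
theorem pathDist_walk_le (hP : IsTarget m b m' b' P) {opA opB : ℕ → List Bool → Op}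
    (hA : opA = delay (react enc P.length m b accA))
    (hB : opB = react enc P.length m' b' accB) {bad : ℕ → Prop}
    (hbadA : ∀ i, ¬ bad i → accA i ≠ none → ∀ j ≤ i, decode enc accA i j = opStream opB j)
    (hbadB : ∀ i, ¬ bad i → accB i ≠ none → ∀ j ≤ i, decode enc accB i j = opStream opA j)
    (n : ℕ) :
    pathDist P (walk opA (n + 1)) + pathDist P (walk opB n) ≤
      (2 * P.length - ((Finset.range n).filter fun i =>
        (accA i ≠ none ∧ accB i ≠ none) ∧ ¬ bad i).card) +
      2 * ((Finset.range n).filter bad).card := by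
  have iA : ∀ n, Follows m b (walk opA n) ∧ (walk opA n).length ≤ P.length :=
    hA ▸ invariant_walk delay_react_eq
  have iB : ∀ n, Follows m' b' (walk opB n) ∧ (walk opB n).length ≤ P.length :=
    hB ▸ invariant_walk react_eq
  induction n with
  | zero =>
    have h1 : walk opA 1 = [] := by rw [hA]; rfl
    have h2 : walk opB 0 = [] := rfl
    have h3 : pathDist P [] = P.length := by simp [pathDist, lcp]
    simp only [zero_add, h1, h2, h3]
    simp
    omega
  | succ n ih =>
    rw [card_filter_range_succ, card_filter_range_succ]
    have hA' : walk opA (n + 1 + 1) =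
        applyOp (react enc P.length m b accA n (walk opA (n + 1))) (walk opA (n + 1)) := by
      rw [walk, hA]; rfl
    have hB' : walk opB (n + 1) =
        applyOp (react enc P.length m' b' accB n (walk opB n)) (walk opB n) := by
      rw [walk, hB]
    by_cases hb : bad n
    · have h1 := pathDist_applyOp_le P (walk opA (n + 1))
        (react enc P.length m b accA n (walk opA (n + 1)))
      have h2 := pathDist_applyOp_le P (walk opB n) (react enc P.length m' b' accB n (walk opB n))
      rw [← hA'] at h1
      rw [← hB'] at h2
      simp only [hb, not_true, and_false, if_false, if_true]
      omega
    · have eB : accB n ≠ none → walk opB (n + 1) =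
          applyOp (move P.length m' b' (walk opB n) (walk opA (n + 1))) (walk opB n) := by
        intro h
        rw [hB', react_of_decoded h (hbadB n hb h)]
      have eA : accA n ≠ none → walk opA (n + 1 + 1) =
          applyOp (move P.length m b (walk opA (n + 1)) (walk opB (n + 1))) (walk opA (n + 1)) := by
        intro h
        rw [hA', react_of_decoded h (hbadA n hb h)]
      have eB0 : accB n = none → walk opB (n + 1) = walk opB n := by
        intro h
        rw [hB', react, if_pos h]; rfl
      have eA0 : accA n = none → walk opA (n + 1 + 1) = walk opA (n + 1) := by
        intro h
        rw [hA', react, if_pos h]; rfl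
      have lB : pathDist P (walk opB (n + 1)) ≤ pathDist P (walk opB n) := by
        by_cases h : accB n = none
        · rw [eB0 h]
        · rw [eB h]
          exact pathDist_move_le hP.symm (iB n).1 (iA _).1 (iB n).2
      have lA : pathDist P (walk opA (n + 1 + 1)) ≤ pathDist P (walk opA (n + 1)) := by
        by_cases h : accA n = none
        · rw [eA0 h]
        · rw [eA h]
          exact pathDist_move_le hP (iA _).1 (iB _).1 (iA _).2
      simp only [hb, not_false_eq_true, and_true, if_false, add_zero]
      split_ifs with hg
      · have := pathDist_move_move hP (iA (n + 1)).1 (iB n).1 (iA _).2 (iB n).2 (eB hg.2)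
        rw [← eA hg.1] at this
        omega
      · omega

open Classical in
/-- If few symbols are forged and in sufficiently many iterations both parties accept a symbol, then
both parties reach a long prefix of the target path. -/
theorem le_lcp_walk (hP : IsTarget m b m' b' P) {h n N : ℕ} (henc : IsTreeCode h N enc)
    (hh : 0 < h) (hN : N = h * n) (hPl : P.length = 9 * n) {opA opB : ℕ → List Bool → Op}
    (hA : opA = delay (react enc P.length m b accA))
    (hB : opB = react enc P.length m' b' accB)
    (hforged : (forgedTimes enc accB (opStream opA) N).card +
      (forgedTimes enc accA (opStream opB) N).card ≤ n)
    (hgood : 32 * n ≤ ((Finset.range N).filter fun i => accA i ≠ none ∧ accB i ≠ none).card) :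
    n ≤ lcp (walk opA (N + 1)) P ∧ n ≤ lcp (walk opB N) P := by
  obtain ⟨bad, hbad⟩ : ∃ bad : ℕ → Prop, ∀ i, bad i ↔
      (accA i ≠ none ∧ ∃ j ≤ i, decode enc accA i j ≠ opStream opB j) ∨
        (accB i ≠ none ∧ ∃ j ≤ i, decode enc accB i j ≠ opStream opA j) := ⟨_, fun _ => Iff.rfl⟩
  have key := pathDist_walk_le (bad := bad) hP hA hB
    (fun i hb ha j hj => by
      by_contra hne
      exact hb ((hbad i).mpr <| Or.inl ⟨ha, j, hj, hne⟩))
    (fun i hb ha j hj => by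
      by_contra hne
      exact hb ((hbad i).mpr <| Or.inr ⟨ha, j, hj, hne⟩)) N
  have mA := card_misdecoded_le henc accA (opStream opB) N le_rfl
  have mB := card_misdecoded_le henc accB (opStream opA) N le_rfl
  -- As `N = h * n`, the code's own contribution to the misdecoded times is `N / h = n`.
  have cA : (misdecodedTimes enc accA (opStream opB) N).card ≤
      n + 2 * (forgedTimes enc accA (opStream opB) N).card := by
    refine Nat.le_of_mul_le_mul_left (mA.trans (le_of_eq ?_)) hh
    rw [hN]; ring
  have cB : (misdecodedTimes enc accB (opStream opA) N).card ≤
      n + 2 * (forgedTimes enc accB (opStream opA) N).card := by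
    refine Nat.le_of_mul_le_mul_left (mB.trans (le_of_eq ?_)) hh
    rw [hN]; ring
  have cbad : ((Finset.range N).filter bad).card ≤
      (misdecodedTimes enc accA (opStream opB) N).card +
        (misdecodedTimes enc accB (opStream opA) N).card := by
    refine le_trans (Finset.card_le_card ?_) (Finset.card_union_le _ _)
    intro i hi
    simp only [misdecodedTimes, Finset.mem_filter, Finset.mem_union, hbad] at hi ⊢
    exact hi.2.imp (fun h => ⟨hi.1, h⟩) fun h => ⟨hi.1, h⟩
  have cgood : ((Finset.range N).filter fun i => accA i ≠ none ∧ accB i ≠ none).card ≤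
      ((Finset.range N).filter fun i => (accA i ≠ none ∧ accB i ≠ none) ∧ ¬ bad i).card +
        ((Finset.range N).filter bad).card := by
    refine le_trans (Finset.card_le_card ?_) (Finset.card_union_le _ _)
    intro i hi
    simp only [Finset.mem_filter, Finset.mem_union] at hi ⊢
    by_cases hb : bad i
    · exact Or.inr ⟨hi.1, hb⟩
    · exact Or.inl ⟨hi.1, hi.2, hb⟩
  have l1 := lcp_le_left (walk opA (N + 1)) P
  have l2 := lcp_le_left (walk opB N) P
  -- At most `2 * n + 2 * n` iterations are bad, so at least `28 * n` good ones remain, more than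
  -- the initial total distance `18 * n`. The final distances thus sum to at most `8 * n`. As the
  -- target has length `9 * n`, each path shares at least `n` steps with it.
  simp only [pathDist] at key
  omega

end Simulation

/-! ### Signed symbols -/

section Signing

variable {F Tag Γ : Type*}

/-- A symbol with its tag under the key `ρ`. -/
def sign (e : F × Tag ≃ Γ) (ρ : F → Tag) (τ : Option F) : Option Γ := τ.map fun σ => e (σ, ρ σ)

open Classical in
/-- The symbol received, if its tag is the one given by the key `ρ`. -/
noncomputable def check (e : F × Tag ≃ Γ) (ρ : F → Tag) (z : Option Γ) : Option F :=
  z.bind fun γ => if ρ (e.symm γ).1 = (e.symm γ).2 then some (e.symm γ).1 else none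

theorem check_sign (e : F × Tag ≃ Γ) (ρ : F → Tag) (τ : Option F) :
    check e ρ (sign e ρ τ) = τ := by
  cases τ <;> simp [check, sign]

theorem sign_isSome (e : F × Tag ≃ Γ) (ρ : F → Tag) (τ : Option F) :
    (sign e ρ τ).isSome = τ.isSome := by
  cases τ <;> rfl

theorem exists_of_check {e : F × Tag ≃ Γ} {ρ : F → Tag} {z : Option Γ} {σ : F}
    (h : check e ρ z = some σ) : ∃ γ, z = some γ ∧ (e.symm γ).1 = σ ∧ ρ σ = (e.symm γ).2 := by
  cases z with
  | none => simp [check] at h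
  | some γ =>
    simp only [check, Option.bind_some] at h
    split_ifs at h with h1
    rw [Option.some.injEq] at h
    exact ⟨γ, rfl, h, h ▸ h1⟩

open Classical in
/-- Without knowledge of the key, a forgery succeeds for at most a `1 / |Tag|` fraction of keys. -/
theorem card_forgery_le [Fintype F] [Fintype Tag] (e : F × Tag ≃ Γ) (τ : Option F)
    (g : Option Γ → Option Γ) :
    (Finset.univ.filter fun ρ : F → Tag =>
      ∃ σ, check e ρ (g (sign e ρ τ)) = some σ ∧ τ ≠ some σ).card * Fintype.card Tag ≤
      Fintype.card (F → Tag) := by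
  rw [← Finset.card_univ (α := Tag), ← Finset.card_product, ← Finset.card_univ (α := F → Tag)]
  -- Overwriting a forging key at the forged symbol by an arbitrary tag is injective. The forged
  -- symbol is not the one sent, so the signed message, and with it the adversary's answer, is
  -- unchanged; that answer carries both the forged symbol and the overwritten tag.
  refine Finset.card_le_card_of_injOn (fun p => match g (sign e p.1 τ) with
    | none => p.1
    | some γ => Function.update p.1 (e.symm γ).1 p.2)
    (fun _ _ => Finset.mem_coe.mpr (Finset.mem_univ _)) ?_
  rintro ⟨ρ, c⟩ hρ ⟨ρ', c'⟩ hρ' heq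
  simp only [Finset.coe_product, Set.mem_prod, Finset.mem_coe, Finset.mem_filter,
    Finset.mem_univ, true_and, and_true] at hρ hρ'
  obtain ⟨σ, h1, h2⟩ := hρ
  obtain ⟨σ', h1', h2'⟩ := hρ'
  obtain ⟨γ, h3, h4, h5⟩ := exists_of_check h1
  obtain ⟨γ', h3', h4', h5'⟩ := exists_of_check h1'
  simp only [h3, h3', h4, h4'] at heq
  have upd : ∀ (ρ : F → Tag) (σ : F) (c : Tag), τ ≠ some σ →
      sign e (Function.update ρ σ c) τ = sign e ρ τ := by
    intro ρ σ c h
    cases τ with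
    | none => rfl
    | some s =>
      have : s ≠ σ := fun hs => h (by rw [hs])
      simp [sign, Function.update_of_ne this]
  have hs : sign e ρ τ = sign e ρ' τ := by
    rw [← upd ρ σ c h2, heq, upd ρ' σ' c' h2']
  have hγ : γ = γ' := by
    rw [hs, h3'] at h3
    exact (Option.some.inj h3).symm
  subst hγ
  have hσ : σ = σ' := h4.symm.trans h4'
  subst hσ
  have hc : c = c' := by simpa using congrFun heq σ
  have hρρ : ρ = ρ' := by
    funext s
    by_cases hsσ : s = σ
    · rw [hsσ, h5, h5']
    · simpa [Function.update_of_ne hsσ] using congrFun heq s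
  rw [hc, hρρ]

end Signing

/-! ### The coding scheme -/

/-- Parameters of the coding scheme: how often Bob repeats an answer, the format of the signed
symbols, the tree code, and the maximal length of the simulated paths. -/
structure Scheme (F : Type*) (Tag : Type*) (Γ : Type*) where
  reps : ℕ
  format : F × Tag ≃ Γ
  enc : (ℕ → Op) → ℕ → F
  cap : ℕ

theorem findSome?_congr_of_mem {A B : Type*} {l : List A} {f g : A → Option B}
    (h : ∀ a ∈ l, f a = g a) : l.findSome? f = l.findSome? g := by
  induction l with
  | nil => rfl
  | cons a l ih =>
    rw [List.findSome?_cons, List.findSome?_cons, h a List.mem_cons_self,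
      ih fun c hc => h c (List.mem_cons_of_mem _ hc)]

namespace Scheme

variable {F Tag Γ : Type*} (S : Scheme F Tag Γ)

/-- The number of rounds of an iteration. -/
def len : ℕ := S.reps + 1

theorem len_pos : 0 < S.len := Nat.succ_pos _

/-- The symbol that Bob accepts in an iteration. -/
noncomputable def accB (ω : ℕ → F → Tag) (z : ℕ → Option Γ) (i : ℕ) : Option F :=
  check S.format (ω (S.len * i)) (z (S.len * i))

/-- The symbol that Alice accepts in an iteration. -/
noncomputable def accA (ω : ℕ → F → Tag) (z : ℕ → Option Γ) (i : ℕ) : Option F :=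
  (List.range S.reps).findSome? fun o =>
    check S.format (ω (S.len * i + (o + 1))) (z (S.len * i + (o + 1)))

/-- Alice's strategy in the simulation. -/
noncomputable def opA (m b : List Bool → Bool) (ω : ℕ → F → Tag) (z : ℕ → Option Γ) :
    ℕ → List Bool → Op :=
  delay (react S.enc S.cap m b (S.accA ω z))

/-- Bob's strategy in the simulation. -/
noncomputable def opB (m b : List Bool → Bool) (ω : ℕ → F → Tag) (z : ℕ → Option Γ) :
    ℕ → List Bool → Op :=
  react S.enc S.cap m b (S.accB ω z)

/-- The unsigned symbol that Alice sends. -/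
noncomputable def planA (m b : List Bool → Bool) (ω : ℕ → F → Tag) (z : ℕ → Option Γ) (r : ℕ) :
    Option F :=
  if r % S.len = 0 then some (S.enc (opStream (S.opA m b ω z)) (r / S.len)) else none

open Classical in
/-- The unsigned symbol that Bob sends. -/
noncomputable def planB (m b : List Bool → Bool) (ω : ℕ → F → Tag) (z : ℕ → Option Γ) (r : ℕ) :
    Option F :=
  if r % S.len = 0 then none
  else if S.accB ω z (r / S.len) = none then none
  else some (S.enc (opStream (S.opB m b ω z)) (r / S.len))

/-- A list as a sequence, continued by silence. -/
def asSeq (l : List (Option Γ)) (j : ℕ) : Option Γ := l.getD j none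

/-- What Alice sends after she has received `l`. -/
noncomputable def sendA (m b : List Bool → Bool) (ω : ℕ → F → Tag) (l : List (Option Γ)) :
    Option Γ :=
  sign S.format (ω l.length) (S.planA m b ω (asSeq l) l.length)

/-- What Bob sends after he has received `l`. -/
noncomputable def sendB (m b : List Bool → Bool) (ω : ℕ → F → Tag) (l : List (Option Γ)) :
    Option Γ :=
  sign S.format (ω l.length) (S.planB m b ω (asSeq l) l.length)

variable {S} {m b m' b' : List Bool → Bool} {ω ω' : ℕ → F → Tag} {z z' : ℕ → Option Γ}

theorem accB_congr {i n : ℕ} (hi : S.len * i < n) (hω : ∀ j < n, ω j = ω' j)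
    (hz : ∀ j < n, z j = z' j) : S.accB ω z i = S.accB ω' z' i := by
  rw [accB, accB, hω _ hi, hz _ hi]

theorem accA_congr {i n : ℕ} (hi : S.len * (i + 1) ≤ n) (hω : ∀ j < n, ω j = ω' j)
    (hz : ∀ j < n, z j = z' j) : S.accA ω z i = S.accA ω' z' i := by
  rw [accA, accA]
  refine findSome?_congr_of_mem fun o ho => ?_
  have h1 : o < S.reps := List.mem_range.mp ho
  have h2 : S.len * i + (o + 1) < n := by
    have h3 : S.len * (i + 1) = S.len * i + (S.reps + 1) := by rw [Nat.mul_succ]; rfl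
    omega
  rw [hω _ h2, hz _ h2]

theorem walk_opA_congr {n N : ℕ} (hn : S.len * N ≤ n) (hω : ∀ j < n, ω j = ω' j)
    (hz : ∀ j < n, z j = z' j) :
    ∀ i ≤ N, S.opA m b ω z i = S.opA m b ω' z' i := fun i hi =>
  delay_react_congr fun j hj =>
    accA_congr ((Nat.mul_le_mul_left _ (by omega)).trans hn) hω hz

theorem walk_opB_congr {n N : ℕ} (hn : S.len * N < n) (hω : ∀ j < n, ω j = ω' j)
    (hz : ∀ j < n, z j = z' j) :
    ∀ i ≤ N, S.opB m b ω z i = S.opB m b ω' z' i := fun i hi =>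
  react_congr fun j hj =>
    accB_congr ((Nat.mul_le_mul_left _ (by omega)).trans_lt hn) hω hz

/-- Causality of the code is what makes the schedule executable: the encoder formally takes an
infinite sequence, but the symbol of round `r` uses only operations already fixed by earlier rounds.
-/
theorem planA_congr (hS : ∀ a a' j, (∀ i ≤ j, a i = a' i) → S.enc a j = S.enc a' j) {r : ℕ}
    (hω : ∀ j < r, ω j = ω' j) (hz : ∀ j < r, z j = z' j) :
    S.planA m b ω z r = S.planA m b ω' z' r := by
  unfold planA
  split_ifs with h
  · congr 1
    refine hS _ _ _ fun i hi => opStream_congr fun j hj => ?_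
    exact walk_opA_congr (Nat.mul_div_le r S.len) hω hz j (hj.trans hi)
  · rfl

theorem planB_congr (hS : ∀ a a' j, (∀ i ≤ j, a i = a' i) → S.enc a j = S.enc a' j) {r : ℕ}
    (hω : ∀ j < r, ω j = ω' j) (hz : ∀ j < r, z j = z' j) :
    S.planB m b ω z r = S.planB m b ω' z' r := by
  unfold planB
  by_cases h : r % S.len = 0
  · rw [if_pos h, if_pos h]
  · have hlt : S.len * (r / S.len) < r := by
      have := Nat.div_add_mod r S.len
      omega
    rw [if_neg h, if_neg h, accB_congr hlt hω hz]
    split_ifs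
    · rfl
    · congr 1
      refine hS _ _ _ fun i hi => opStream_congr fun j hj => ?_
      exact walk_opB_congr hlt hω hz j (hj.trans hi)

theorem asSeq_map_range (f : ℕ → Option Γ) {n j : ℕ} (h : j < n) :
    asSeq ((List.range n).map f) j = f j := by
  simp [asSeq, h]

/-! ### Executions -/

variable (S) (m b m' b')

/-- The first rounds of the execution with keys `ω` against `eve`. -/
noncomputable def run (ω : ℕ → F → Tag) (eve : Adversary Γ) : ℕ → List (Round Γ)
  | 0 => []
  | n + 1 =>
    let h := run ω eve n
    let s := S.sendA m b ω (h.map Round.recvA)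
    let t := S.sendB m' b' ω (h.map Round.recvB)
    h ++ [{ sentA := s, sentB := t, recvA := (eve h s t).2, recvB := (eve h s t).1 }]

/-- A round of the execution. -/
noncomputable def rnd (ω : ℕ → F → Tag) (eve : Adversary Γ) (n : ℕ) : Round Γ :=
  let h := S.run m b m' b' ω eve n
  let s := S.sendA m b ω (h.map Round.recvA)
  let t := S.sendB m' b' ω (h.map Round.recvB)
  { sentA := s, sentB := t, recvA := (eve h s t).2, recvB := (eve h s t).1 }

/-- The sequence of what Alice receives. -/
noncomputable def rcvA (ω : ℕ → F → Tag) (eve : Adversary Γ) (n : ℕ) : Option Γ :=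
  (S.rnd m b m' b' ω eve n).recvA

/-- The sequence of what Bob receives. -/
noncomputable def rcvB (ω : ℕ → F → Tag) (eve : Adversary Γ) (n : ℕ) : Option Γ :=
  (S.rnd m b m' b' ω eve n).recvB

/-- A symbol is accepted that was not sent in this round. -/
def Forged (ω : ℕ → F → Tag) (eve : Adversary Γ) (r : ℕ) : Prop :=
  if r % S.len = 0 then
    ∃ σ, check S.format (ω r) (S.rcvB m b m' b' ω eve r) = some σ ∧
      S.planA m b ω (S.rcvA m b m' b' ω eve) r ≠ some σ
  else
    ∃ σ, check S.format (ω r) (S.rcvA m b m' b' ω eve r) = some σ ∧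
      S.planB m' b' ω (S.rcvB m b m' b' ω eve) r ≠ some σ

variable {S m b m' b'} {eve : Adversary Γ}

theorem run_eq_map (n : ℕ) :
    S.run m b m' b' ω eve n = (List.range n).map (S.rnd m b m' b' ω eve) := by
  induction n with
  | zero => rfl
  | succ n ih =>
    rw [List.range_succ, List.map_append, ← ih]
    rfl

theorem map_recvA_run (n : ℕ) : (S.run m b m' b' ω eve n).map Round.recvA =
    (List.range n).map (S.rcvA m b m' b' ω eve) := by
  rw [run_eq_map, List.map_map]; rfl

theorem map_recvB_run (n : ℕ) : (S.run m b m' b' ω eve n).map Round.recvB =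
    (List.range n).map (S.rcvB m b m' b' ω eve) := by
  rw [run_eq_map, List.map_map]; rfl

variable (hS : ∀ a a' j, (∀ i ≤ j, a i = a' i) → S.enc a j = S.enc a' j)
include hS

theorem sentA_rnd (n : ℕ) : (S.rnd m b m' b' ω eve n).sentA =
    sign S.format (ω n) (S.planA m b ω (S.rcvA m b m' b' ω eve) n) := by
  change S.sendA m b ω _ = _
  rw [map_recvA_run, sendA, List.length_map, List.length_range,
    planA_congr hS (fun _ _ => rfl) fun j hj => asSeq_map_range _ hj]

theorem sentB_rnd (n : ℕ) : (S.rnd m b m' b' ω eve n).sentB =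
    sign S.format (ω n) (S.planB m' b' ω (S.rcvB m b m' b' ω eve) n) := by
  change S.sendB m' b' ω _ = _
  rw [map_recvB_run, sendB, List.length_map, List.length_range,
    planB_congr hS (fun _ _ => rfl) fun j hj => asSeq_map_range _ hj]

theorem rcvA_eq (n : ℕ) : S.rcvA m b m' b' ω eve n = (eve (S.run m b m' b' ω eve n)
    (sign S.format (ω n) (S.planA m b ω (S.rcvA m b m' b' ω eve) n))
    (sign S.format (ω n) (S.planB m' b' ω (S.rcvB m b m' b' ω eve) n))).2 := by
  rw [← sentA_rnd hS, ← sentB_rnd hS]; rfl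

theorem rcvB_eq (n : ℕ) : S.rcvB m b m' b' ω eve n = (eve (S.run m b m' b' ω eve n)
    (sign S.format (ω n) (S.planA m b ω (S.rcvA m b m' b' ω eve) n))
    (sign S.format (ω n) (S.planB m' b' ω (S.rcvB m b m' b' ω eve) n))).1 := by
  rw [← sentA_rnd hS, ← sentB_rnd hS]; rfl

/-- The adversary sees a key only through transmissions already signed with it, so the first `n`
rounds are determined by the first `n` keys. This makes forgeries adapted events. -/
theorem rcv_congr {n : ℕ} (hω : ∀ j < n, ω j = ω' j) :
    (∀ j < n, S.rcvA m b m' b' ω eve j = S.rcvA m b m' b' ω' eve j) ∧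
    (∀ j < n, S.rcvB m b m' b' ω eve j = S.rcvB m b m' b' ω' eve j) ∧
    S.run m b m' b' ω eve n = S.run m b m' b' ω' eve n := by
  induction n with
  | zero => exact ⟨fun j hj => absurd hj (Nat.not_lt_zero j),
      fun j hj => absurd hj (Nat.not_lt_zero j), rfl⟩
  | succ n ih =>
    have hω' : ∀ j < n, ω j = ω' j := fun j hj => hω j (by omega)
    obtain ⟨hA, hB, hR⟩ := ih hω'
    have eA := rcvA_eq (m := m) (b := b) (m' := m') (b' := b') (ω := ω) (eve := eve) hS n
    have eB := rcvB_eq (m := m) (b := b) (m' := m') (b' := b') (ω := ω) (eve := eve) hS n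
    have sA := sentA_rnd (m := m) (b := b) (m' := m') (b' := b') (ω := ω) (eve := eve) hS n
    have sB := sentB_rnd (m := m) (b := b) (m' := m') (b' := b') (ω := ω) (eve := eve) hS n
    rw [planA_congr hS hω' hA, hω n (by omega)] at eA eB sA
    rw [planB_congr hS hω' hB] at eA eB
    rw [planB_congr hS hω' hB, hω n (by omega)] at sB
    rw [hR] at eA eB
    rw [← rcvA_eq hS] at eA
    rw [← rcvB_eq hS] at eB
    rw [← sentA_rnd hS] at sA
    rw [← sentB_rnd hS] at sB
    refine ⟨fun j hj => ?_, fun j hj => ?_, ?_⟩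
    · rcases Nat.lt_succ_iff_lt_or_eq.mp hj with h | rfl
      exacts [hA j h, eA]
    · rcases Nat.lt_succ_iff_lt_or_eq.mp hj with h | rfl
      exacts [hB j h, eB]
    · have : S.rnd m b m' b' ω eve n = S.rnd m b m' b' ω' eve n := by
        revert sA sB eA eB
        unfold rcvA rcvB
        rcases S.rnd m b m' b' ω eve n with ⟨a1, a2, a3, a4⟩
        rcases S.rnd m b m' b' ω' eve n with ⟨b1, b2, b3, b4⟩
        rintro ⟨⟩ ⟨⟩ ⟨⟩ ⟨⟩
        rfl
      rw [run_eq_map, run_eq_map] at hR ⊢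
      rw [List.range_succ, List.map_append, List.map_append, hR]
      simp [this]

theorem forged_congr {r : ℕ} (hω : ∀ j ≤ r, ω j = ω' j) :
    S.Forged m b m' b' ω eve r ↔ S.Forged m b m' b' ω' eve r := by
  have hω' : ∀ j < r, ω j = ω' j := fun j hj => hω j hj.le
  obtain ⟨hA, hB, -⟩ := rcv_congr (m := m) (b := b) (m' := m') (b' := b') (eve := eve) hS hω'
  obtain ⟨hA', hB', -⟩ := rcv_congr (m := m) (b := b) (m' := m') (b' := b') (eve := eve) hS
    (n := r + 1) fun j hj => hω j (Nat.lt_succ_iff.mp hj)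
  unfold Forged
  rw [planA_congr hS hω' hA, planB_congr hS hω' hB, hA' r (by omega), hB' r (by omega),
    hω r le_rfl]

-- Everything before round `r` is independent of its key, and in round `r` one of the two plans is
-- silence. The adversary's answer is therefore a function of a single signed symbol, as
-- `card_forgery_le` requires.
open Classical in
theorem card_forged_update_le [Fintype F] [Fintype Tag] (ω : ℕ → F → Tag) (r : ℕ) :
    (Finset.univ.filter fun ρ => S.Forged m b m' b' (Function.update ω r ρ) eve r).card *
      Fintype.card Tag ≤ Fintype.card (F → Tag) := by
  have hω : ∀ ρ, ∀ j < r, Function.update ω r ρ j = ω j := fun ρ j hj =>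
    Function.update_of_ne hj.ne _ _
  have hcongr := fun ρ => rcv_congr (m := m) (b := b) (m' := m') (b' := b') (eve := eve) hS (hω ρ)
  set H := S.run m b m' b' ω eve r
  by_cases h : r % S.len = 0
  · refine le_trans (le_of_eq ?_) (card_forgery_le S.format
      (S.planA m b ω (S.rcvA m b m' b' ω eve) r) fun s => (eve H s none).1)
    congr 2
    refine Finset.filter_congr fun ρ _ => ?_
    unfold Forged
    rw [if_pos h, rcvB_eq hS, planA_congr hS (hω ρ) (hcongr ρ).1,
      planB_congr hS (hω ρ) (hcongr ρ).2.1, (hcongr ρ).2.2, Function.update_self]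
    have : S.planB m' b' ω (S.rcvB m b m' b' ω eve) r = none := by rw [planB, if_pos h]
    rw [this]
    rfl
  · refine le_trans (le_of_eq ?_) (card_forgery_le S.format
      (S.planB m' b' ω (S.rcvB m b m' b' ω eve) r) fun s => (eve H none s).2)
    congr 2
    refine Finset.filter_congr fun ρ _ => ?_
    unfold Forged
    rw [if_neg h, rcvA_eq hS, planA_congr hS (hω ρ) (hcongr ρ).1,
      planB_congr hS (hω ρ) (hcongr ρ).2.1, (hcongr ρ).2.2, Function.update_self]
    have : S.planA m b ω (S.rcvA m b m' b' ω eve) r = none := by rw [planA, if_neg h]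
    rw [this]
    rfl

end Scheme

/-! ### Communication and noise per iteration -/

theorem sum_range_mul_eq (f : ℕ → ℕ) (L N : ℕ) :
    ∑ r ∈ Finset.range (L * N), f r =
      ∑ i ∈ Finset.range N, ∑ o ∈ Finset.range L, f (L * i + o) := by
  induction N with
  | zero => simp
  | succ N ih => rw [Nat.mul_succ, Finset.sum_range_add, ih, Finset.sum_range_succ]

/-- Number of non-silent transmissions of a round. -/
def Round.comm {Γ : Type*} (ρ : Round Γ) : ℕ :=
  (if ρ.sentA.isSome then 1 else 0) + (if ρ.sentB.isSome then 1 else 0)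

open Classical in
/-- Number of changed transmissions of a round. -/
noncomputable def Round.noise {Γ : Type*} (ρ : Round Γ) : ℕ :=
  (if ρ.recvB = ρ.sentA then 0 else 1) + (if ρ.recvA = ρ.sentB then 0 else 1)

theorem sum_map_range {A : Type*} (f : A → ℕ) (g : ℕ → A) (n : ℕ) :
    (((List.range n).map g).map f).sum = ∑ r ∈ Finset.range n, f (g r) := by
  induction n with
  | zero => rfl
  | succ n ih => simp [List.range_succ, Finset.sum_range_succ, ← ih]

namespace Scheme

variable {F Tag Γ : Type*} {S : Scheme F Tag Γ} {m b m' b' : List Bool → Bool}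
  {ω : ℕ → F → Tag} {eve : Adversary Γ} {z : ℕ → Option Γ}

theorem communication_run (n : ℕ) : communication (S.run m b m' b' ω eve n) =
    ∑ r ∈ Finset.range n, (S.rnd m b m' b' ω eve r).comm := by
  rw [run_eq_map, ← sum_map_range]
  rfl

theorem noise_run (n : ℕ) : noise (S.run m b m' b' ω eve n) =
    ∑ r ∈ Finset.range n, (S.rnd m b m' b' ω eve r).noise := by
  rw [run_eq_map, ← sum_map_range]
  rfl

theorem mul_add_mod_len {i o : ℕ} (ho : o < S.len) : (S.len * i + o) % S.len = o := by
  rw [Nat.mul_add_mod, Nat.mod_eq_of_lt ho]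

theorem mul_add_div_len {i o : ℕ} (ho : o < S.len) : (S.len * i + o) / S.len = i := by
  rw [Nat.mul_add_div S.len_pos, Nat.div_eq_of_lt ho, add_zero]

theorem planA_start (i : ℕ) : S.planA m b ω z (S.len * i) =
    some (S.enc (opStream (S.opA m b ω z)) i) := by
  rw [planA, Nat.mul_mod_right, if_pos rfl, Nat.mul_div_cancel_left _ S.len_pos]

theorem planA_later {i o : ℕ} (ho : o < S.reps) :
    S.planA m b ω z (S.len * i + (o + 1)) = none := by
  rw [planA, mul_add_mod_len (Nat.succ_lt_succ ho), if_neg (Nat.succ_ne_zero o)]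

theorem planB_start (i : ℕ) : S.planB m b ω z (S.len * i) = none := by
  rw [planB, Nat.mul_mod_right, if_pos rfl]

open Classical in
theorem planB_later {i o : ℕ} (ho : o < S.reps) :
    S.planB m b ω z (S.len * i + (o + 1)) = if S.accB ω z i = none then none
      else some (S.enc (opStream (S.opB m b ω z)) i) := by
  rw [planB, mul_add_mod_len (Nat.succ_lt_succ ho), if_neg (Nat.succ_ne_zero o),
    mul_add_div_len (Nat.succ_lt_succ ho)]

variable (hS : ∀ a a' j, (∀ i ≤ j, a i = a' i) → S.enc a j = S.enc a' j)
include hS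

open Classical in
theorem sum_comm_iteration (i : ℕ) :
    ∑ o ∈ Finset.range S.len, (S.rnd m b m' b' ω eve (S.len * i + o)).comm =
      1 + S.reps * if S.accB ω (S.rcvB m b m' b' ω eve) i = none then 0 else 1 := by
  rw [len, Finset.sum_range_succ', add_comm]
  congr 1
  · change (S.rnd m b m' b' ω eve (S.len * i)).comm = 1
    rw [Round.comm, sentA_rnd hS, sentB_rnd hS, sign_isSome, sign_isSome, planA_start, planB_start]
    rfl
  · rw [Finset.sum_congr rfl (g := fun _ =>
      if S.accB ω (S.rcvB m b m' b' ω eve) i = none then 0 else 1)]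
    · simp
    · intro o ho
      have ho := Finset.mem_range.mp ho
      change (S.rnd m b m' b' ω eve (S.len * i + (o + 1))).comm = _
      rw [Round.comm, sentA_rnd hS, sentB_rnd hS, sign_isSome, sign_isSome, planA_later ho,
        planB_later ho]
      split_ifs <;> simp_all

-- In an iteration where some party accepts nothing, the ratio of noise to communication is at least
-- `reps / len`. In the others the communication is exactly `len`, which the last term pays for.
open Classical in
theorem comm_le_noise_iteration (i : ℕ) :
    S.reps * ∑ o ∈ Finset.range S.len, (S.rnd m b m' b' ω eve (S.len * i + o)).comm ≤
      S.len * ∑ o ∈ Finset.range S.len, (S.rnd m b m' b' ω eve (S.len * i + o)).noise +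
        S.reps * S.len * if S.accA ω (S.rcvA m b m' b' ω eve) i ≠ none ∧
          S.accB ω (S.rcvB m b m' b' ω eve) i ≠ none then 1 else 0 := by
  rw [sum_comm_iteration hS]
  set acA := S.accA ω (S.rcvA m b m' b' ω eve) i with hacA
  set acB := S.accB ω (S.rcvB m b m' b' ω eve) i with hacB
  have hlen : S.len = S.reps + 1 := rfl
  -- An unchanged opening symbol passes the check, so at least one corruption occurred; Bob is then
  -- silent and the communication is `1`.
  by_cases hB : acB = none
  · have h1 : 1 ≤ (S.rnd m b m' b' ω eve (S.len * i + 0)).noise := by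
      rw [Round.noise]
      have : (S.rnd m b m' b' ω eve (S.len * i + 0)).recvB ≠
          (S.rnd m b m' b' ω eve (S.len * i + 0)).sentA := by
        intro h
        rw [sentA_rnd hS, add_zero, planA_start] at h
        rw [hacB, accB, rcvB, h, check_sign] at hB
        exact absurd hB (by simp)
      rw [if_neg this]
      omega
    have h2 := Finset.single_le_sum (f := fun o => (S.rnd m b m' b' ω eve (S.len * i + o)).noise)
      (fun _ _ => Nat.zero_le _) (Finset.mem_range.mpr S.len_pos)
    have h3 := Nat.mul_le_mul_left S.len (h1.trans h2)
    simp only [hB, if_true]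
    omega
  -- One unchanged answer would suffice for Alice, so all `reps` answers were corrupted.
  · by_cases hA : acA = none
    · have h1 : S.reps ≤ ∑ o ∈ Finset.range S.len,
          (S.rnd m b m' b' ω eve (S.len * i + o)).noise := by
        rw [show Finset.range S.len = Finset.range (S.reps + 1) from rfl, Finset.sum_range_succ']
        refine le_trans ?_ (Nat.le_add_right _ _)
        calc S.reps = ∑ _o ∈ Finset.range S.reps, 1 := by simp
          _ ≤ _ := Finset.sum_le_sum fun o ho => ?_
        have ho' := Finset.mem_range.mp ho
        rw [Round.noise]
        have : (S.rnd m b m' b' ω eve (S.len * i + (o + 1))).recvA ≠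
            (S.rnd m b m' b' ω eve (S.len * i + (o + 1))).sentB := by
          intro h
          rw [sentB_rnd hS, planB_later ho', ← hacB, if_neg hB] at h
          rw [hacA, accA, List.findSome?_eq_none_iff] at hA
          have h2 := hA o (List.mem_range.mpr ho')
          rw [rcvA, h, check_sign] at h2
          exact absurd h2 (by simp)
        rw [if_neg this]
        omega
      have h3 := Nat.mul_le_mul_left S.len h1
      simp only [hB, if_false]
      refine le_trans (le_of_eq ?_) (h3.trans (Nat.le_add_right _ _))
      rw [hlen]
      ring
    · simp only [hB, hA, if_false, ne_eq, not_false_eq_true, and_self, if_true, mul_one]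
      refine le_trans (le_of_eq ?_) (Nat.le_add_left _ _)
      rw [hlen]
      ring

open Classical in
theorem comm_le_noise (N : ℕ) :
    S.reps * communication (S.run m b m' b' ω eve (S.len * N)) ≤
      S.len * noise (S.run m b m' b' ω eve (S.len * N)) +
        S.reps * S.len * ((Finset.range N).filter fun i =>
          S.accA ω (S.rcvA m b m' b' ω eve) i ≠ none ∧
            S.accB ω (S.rcvB m b m' b' ω eve) i ≠ none).card := by
  rw [communication_run, noise_run, sum_range_mul_eq, sum_range_mul_eq, Finset.card_filter,
    Finset.mul_sum, Finset.mul_sum, Finset.mul_sum, ← Finset.sum_add_distrib]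
  exact Finset.sum_le_sum fun i _ => comm_le_noise_iteration hS i

/-- Alice speaks in every iteration whatever happens, so the adversary cannot make the communication
small. -/
theorem le_communication (N : ℕ) :
    N ≤ communication (S.run m b m' b' ω eve (S.len * N)) := by
  classical
  rw [communication_run, sum_range_mul_eq]
  calc N = ∑ _i ∈ Finset.range N, 1 := by simp
    _ ≤ _ := Finset.sum_le_sum fun i _ => by
      rw [sum_comm_iteration hS]
      exact Nat.le_add_right _ _

-- Each wrongly accepted symbol is charged to the round in which its check succeeded: the opening
-- round for Bob, one of the answer rounds for Alice.
omit hS in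
open Classical in
theorem card_forgedTimes_le (N : ℕ) :
    (forgedTimes S.enc (S.accB ω (S.rcvB m b m' b' ω eve))
      (opStream (S.opA m b ω (S.rcvA m b m' b' ω eve))) N).card +
    (forgedTimes S.enc (S.accA ω (S.rcvA m b m' b' ω eve))
      (opStream (S.opB m' b' ω (S.rcvB m b m' b' ω eve))) N).card ≤
    ((Finset.range (S.len * N)).filter fun r => S.Forged m b m' b' ω eve r).card := by
  rw [forgedTimes, forgedTimes, Finset.card_filter, Finset.card_filter, Finset.card_filter,
    sum_range_mul_eq, ← Finset.sum_add_distrib]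
  refine Finset.sum_le_sum fun i _ => ?_
  rw [show Finset.range S.len = Finset.range (S.reps + 1) from rfl, Finset.sum_range_succ',
    add_comm (ite _ _ _)]
  refine Nat.add_le_add ?_ ?_
  · split_ifs with h
    · obtain ⟨h1, h2⟩ := h
      obtain ⟨σ, hσ⟩ := Option.ne_none_iff_exists'.mp h1
      have hσ' := hσ
      rw [accA] at hσ'
      obtain ⟨o, ho, hc⟩ := List.exists_of_findSome?_eq_some hσ'
      have ho' := List.mem_range.mp ho
      have hF : S.Forged m b m' b' ω eve (S.len * i + (o + 1)) := by
        rw [Forged, mul_add_mod_len (Nat.succ_lt_succ ho'), if_neg (Nat.succ_ne_zero o)]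
        refine ⟨σ, hc, ?_⟩
        rw [planB_later ho']
        split_ifs
        · simp
        · rw [hσ] at h2
          exact fun h => h2 h.symm
      have := Finset.single_le_sum (f := fun o =>
        if S.Forged m b m' b' ω eve (S.len * i + (o + 1)) then 1 else 0)
        (fun _ _ => Nat.zero_le _) (Finset.mem_range.mpr ho')
      simpa [hF] using this
    · exact Nat.zero_le _
  · split_ifs with h h'
    · exact le_rfl
    · refine absurd ?_ h'
      obtain ⟨h1, h2⟩ := h
      obtain ⟨σ, hσ⟩ := Option.ne_none_iff_exists'.mp h1
      rw [add_zero, Forged, Nat.mul_mod_right, if_pos rfl]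
      refine ⟨σ, hσ, ?_⟩
      rw [planA_start, ← hσ]
      exact fun h => h2 h.symm
    · exact Nat.zero_le _
    · exact le_rfl

omit hS in
open Classical in
/-- If there is not too much noise and there are few forgeries, then the parties simulate the path
correctly. -/
theorem le_lcp_of_noise {P : List Bool} (hP : IsTarget m b m' b' P) {n h N : ℕ} {ε : ℝ}
    (henc : IsTreeCode h N S.enc) (hh : h = 32 * (S.reps * S.len)) (hr : 0 < S.reps)
    (hN : N = h * n) (hcap : S.cap = 9 * n) (hPl : P.length = 9 * n) (hε : 2 ≤ ε * S.len)
    (hnoise : (noise (S.run m b m' b' ω eve (S.len * N)) : ℝ) ≤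
      (1 - ε) * communication (S.run m b m' b' ω eve (S.len * N)))
    (hforged : ((Finset.range (S.len * N)).filter fun r => S.Forged m b m' b' ω eve r).card ≤ n) :
    n ≤ lcp (walk (S.opA m b ω (S.rcvA m b m' b' ω eve)) (N + 1)) P ∧
      n ≤ lcp (walk (S.opB m' b' ω (S.rcvB m b m' b' ω eve)) N) P := by
  have hM : 0 < S.reps * S.len := Nat.mul_pos hr S.len_pos
  have hcapP : S.cap = P.length := by rw [hcap, hPl]
  refine le_lcp_walk (enc := S.enc) (accA := S.accA ω (S.rcvA m b m' b' ω eve))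
    (accB := S.accB ω (S.rcvB m b m' b' ω eve)) hP henc (by omega) hN hPl
    (by rw [opA, hcapP]) (by rw [opB, hcapP]) ((card_forgedTimes_le N).trans hforged) ?_
  have h1 := comm_le_noise (m := m) (b := b) (m' := m') (b' := b') (ω := ω) (eve := eve)
    henc.causal N
  have h2 := le_communication (m := m) (b := b) (m' := m') (b' := b') (ω := ω) (eve := eve)
    henc.causal N
  set G := ((Finset.range N).filter fun i => S.accA ω (S.rcvA m b m' b' ω eve) i ≠ none ∧
            S.accB ω (S.rcvB m b m' b' ω eve) i ≠ none).card
  set c := communication (S.run m b m' b' ω eve (S.len * N))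
  set ν := noise (S.run m b m' b' ω eve (S.len * N))
  have h1' : (S.reps : ℝ) * c ≤ S.len * ν + S.reps * S.len * G := by exact_mod_cast h1
  have hlen : (S.len : ℝ) = S.reps + 1 := by rw [len]; push_cast; ring
  have h3 : (S.len : ℝ) * ν ≤ S.len * ((1 - ε) * c) := by gcongr
  have hc0 : (0 : ℝ) ≤ c := Nat.cast_nonneg c
  -- Since `len = reps + 1`, the inequalities give `(ε * len - 1) * c ≤ reps * len * G`, and `ε *
  -- len ≥ 2`.
  have h4 : (c : ℝ) ≤ S.reps * S.len * G := by nlinarith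
  have h5 : c ≤ S.reps * S.len * G := by exact_mod_cast h4
  have h6 : S.reps * S.len * (32 * n) ≤ S.reps * S.len * G := by
    calc S.reps * S.len * (32 * n) = N := by rw [hN, hh]; ring
      _ ≤ _ := h2.trans h5
  exact Nat.le_of_mul_le_mul_left h6 hM

end Scheme

/-! ### The theorem -/

open Classical in
/-- A bound on the probability over `Ω` for each fixed value of an independent random variable
bounds the probability. -/
theorem toOuterMeasure_uniform_bind_le {Ω E : Type*} [Fintype Ω] [Nonempty Ω] (eve : PMF E)
    (B : Set (Ω × E)) (β : ℝ≥0∞)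
    (h : ∀ e, ∀ A : Finset Ω, (∀ r ∈ A, (r, e) ∈ B) → (A.card : ℝ≥0∞) ≤ β * Fintype.card Ω) :
    ((PMF.uniformOfFintype Ω).bind fun r => eve.map fun e => (r, e)).toOuterMeasure B ≤ β := by
  rw [PMF.toOuterMeasure_bind_apply]
  simp only [PMF.toOuterMeasure_map_apply]
  simp only [PMF.toOuterMeasure_apply, PMF.uniformOfFintype_apply,
    ← ENNReal.tsum_mul_left]
  rw [ENNReal.tsum_comm]
  calc _ ≤ ∑' e, β * eve e := ENNReal.tsum_le_tsum fun e => ?_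
    _ = β := by rw [ENNReal.tsum_mul_left, PMF.tsum_coe, mul_one]
  rw [tsum_fintype, ← Finset.mul_sum]
  have : ∑ r : Ω, Set.indicator ((fun e => (r, e)) ⁻¹' B) (⇑eve) e =
      ((Finset.univ.filter fun r => (r, e) ∈ B).card : ℝ≥0∞) * eve e := by
    rw [Finset.card_filter, Nat.cast_sum, Finset.sum_mul]
    refine Finset.sum_congr rfl fun r _ => ?_
    by_cases hr : (r, e) ∈ B <;> simp [Set.indicator, hr]
  rw [this, ← mul_assoc]
  gcongr
  rw [← ENNReal.div_eq_inv_mul]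
  exact ENNReal.div_le_of_le_mul (h e _ fun r hr => (Finset.mem_filter.mp hr).2)

open Classical in
theorem card_filter_range_eq (p : ℕ → Prop) (T : ℕ) :
    ((Finset.range T).filter p).card = (Finset.univ.filter fun t : Fin T => p t).card := by
  rw [Finset.card_filter, Finset.card_filter, Finset.sum_range]

/-! ### The protocol and its probability of failure -/

namespace Scheme

variable {F Tag Γ : Type*} [Fintype F] [Fintype Tag] [Inhabited Tag] {S : Scheme F Tag Γ}
  {m b m' b' : List Bool → Bool}

open Classical in
/-- Many forgeries are unlikely. -/
theorem card_many_forged_le (hS : ∀ a a' j, (∀ i ≤ j, a i = a' i) → S.enc a j = S.enc a' j)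
    (eve : Adversary Γ) (T n : ℕ) :
    (Finset.univ.filter fun ω : Fin T → F → Tag => n ≤ ((Finset.range T).filter fun r =>
      S.Forged m b m' b' (extend ω) eve r).card).card * Fintype.card Tag ^ n ≤
      2 ^ T * Fintype.card (F → Tag) ^ T := by
  have hmain := card_many_bad_le (T := T) (R := F → Tag) (Fintype.card Tag) Fintype.card_pos
    (fun t ω => S.Forged m b m' b' (extend ω) eve t) ?_ ?_ T le_rfl n
  · refine le_of_eq_of_le ?_ hmain
    congr 2
    refine Finset.filter_congr fun ω _ => ?_
    rw [card_filter_range_eq]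
    simp
  · intro t ω ω' h
    refine forged_congr hS fun j hj => ?_
    have hjT : j < T := lt_of_le_of_lt hj t.2
    rw [extend, extend, dif_pos hjT, dif_pos hjT]
    exact h _ hj
  · intro t ω
    simp only [extend_update]
    exact card_forged_update_le hS _ _

variable {X Y Z : Type*}

/-- The protocol that simulates a protocol tree in `N` iterations by means of a coding scheme. -/
noncomputable def protocol (S : Scheme F Tag Γ) (t : ProtocolTree X Y Z) (z₀ : Z) (N : ℕ)
    {seedLen : ℕ} (φ : (Fin seedLen → Bool) ≃ (Fin (S.len * N) → F → Tag)) :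
    SharedProtocol X Y Z Γ where
  rounds := S.len * N
  seedLen := seedLen
  sendA x r := S.sendA (fun v => (t.subtree v).rootAlice) (fun v => (t.subtree v).rootBitA x)
    (extend (φ r))
  sendB y r := S.sendB (fun v => !(t.subtree v).rootAlice) (fun v => (t.subtree v).rootBitB y)
    (extend (φ r))
  outA x r l := (t.subtree (walk (S.opA (fun v => (t.subtree v).rootAlice)
    (fun v => (t.subtree v).rootBitA x) (extend (φ r)) (asSeq l)) (N + 1))).rootOut z₀
  outB y r l := (t.subtree (walk (S.opB (fun v => !(t.subtree v).rootAlice)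
    (fun v => (t.subtree v).rootBitB y) (extend (φ r)) (asSeq l)) N)).rootOut z₀

omit [Fintype F] [Fintype Tag] [Inhabited Tag] in
theorem history_eq_run (P : SharedProtocol X Y Z Γ) {x : X} {y : Y} {r : Fin P.seedLen → Bool}
    {eve : Adversary Γ} {ω : ℕ → F → Tag} (hA : P.sendA x r = S.sendA m b ω)
    (hB : P.sendB y r = S.sendB m' b' ω) (n : ℕ) :
    P.history x y r eve n = S.run m b m' b' ω eve n := by
  induction n with
  | zero => rfl
  | succ n ih => rw [SharedProtocol.history, ih, hA, hB, run]

omit [Fintype F] [Fintype Tag] in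
theorem transcript_protocol (t : ProtocolTree X Y Z) (z₀ : Z) (N : ℕ) {seedLen : ℕ}
    (φ : (Fin seedLen → Bool) ≃ (Fin (S.len * N) → F → Tag)) (x : X) (y : Y)
    (r : Fin seedLen → Bool) (eve : Adversary Γ) :
    (S.protocol t z₀ N φ).transcript x y r eve =
      S.run (fun v => (t.subtree v).rootAlice) (fun v => (t.subtree v).rootBitA x)
        (fun v => !(t.subtree v).rootAlice) (fun v => (t.subtree v).rootBitB y)
        (extend (φ r)) eve (S.len * N) := by
  exact history_eq_run (S.protocol t z₀ N φ) rfl rfl _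

omit [Fintype F] [Fintype Tag] in
open Classical in
theorem correct_protocol {t : ProtocolTree X Y Z} {f : X → Y → Z} (ht : t.Computes f) (z₀ : Z)
    {n h N : ℕ} (hn : t.depth = n) {ε : ℝ} (hε1 : ε < 1) (henc : IsTreeCode h N S.enc)
    (hh : h = 32 * (S.reps * S.len)) (hr : 0 < S.reps) (hN : N = h * n) (hcap : S.cap = 9 * n)
    (hε : 2 ≤ ε * S.len) {seedLen : ℕ}
    (φ : (Fin seedLen → Bool) ≃ (Fin (S.len * N) → F → Tag)) (x : X) (y : Y)
    (r : Fin seedLen → Bool) (eve : Adversary Γ)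
    (hnoise : noiseRate ((S.protocol t z₀ N φ).transcript x y r eve) ≤ ENNReal.ofReal (1 - ε))
    (hforged : ((Finset.range (S.len * N)).filter fun i =>
      S.Forged (fun v => (t.subtree v).rootAlice) (fun v => (t.subtree v).rootBitA x)
        (fun v => !(t.subtree v).rootAlice) (fun v => (t.subtree v).rootBitB y)
        (extend (φ r)) eve i).card ≤ n) :
    (S.protocol t z₀ N φ).Correct f x y r eve := by
  rw [transcript_protocol] at hnoise
  set m : List Bool → Bool := fun v => (t.subtree v).rootAlice with hm
  set b : List Bool → Bool := fun v => (t.subtree v).rootBitA x with hb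
  set m' : List Bool → Bool := fun v => !(t.subtree v).rootAlice with hm'
  set b' : List Bool → Bool := fun v => (t.subtree v).rootBitB y with hb'
  set ω := extend (φ r) with hω
  have hT : IsTarget m b m' b' (t.inputPath x y (9 * n)) := isTarget_targetPath (fun v => rfl) _
  have hnoise' : (noise (S.run m b m' b' ω eve (S.len * N)) : ℝ) ≤
      (1 - ε) * communication (S.run m b m' b' ω eve (S.len * N)) := by
    rw [noiseRate, ENNReal.div_le_iff_le_mul (Or.inr ENNReal.ofReal_ne_top)
      (Or.inl (ENNReal.natCast_ne_top _)), ← ENNReal.ofReal_natCast, ← ENNReal.ofReal_natCast,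
      ← ENNReal.ofReal_mul (by linarith)] at hnoise
    refine (ENNReal.ofReal_le_ofReal_iff ?_).mp hnoise
    exact mul_nonneg (by linarith) (Nat.cast_nonneg _)
  obtain ⟨hA, hB⟩ := le_lcp_of_noise hT henc hh hr hN hcap (length_targetPath _) hε hnoise' hforged
  have eA : (S.protocol t z₀ N φ).outA x r
      (((S.protocol t z₀ N φ).transcript x y r eve).map Round.recvA) =
      (t.subtree (walk (S.opA m b ω (S.rcvA m b m' b' ω eve)) (N + 1))).rootOut z₀ := by
    rw [transcript_protocol, map_recvA_run]
    change (t.subtree (walk (S.opA m b ω _) (N + 1))).rootOut z₀ = _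
    congr 2
    -- Alice's walk has `N + 1` operations because her delayed strategy still reacts to the answers
    -- of the last iteration after the final round.
    exact walk_congr fun i hi => walk_opA_congr le_rfl (fun _ _ => rfl)
      (fun j hj => asSeq_map_range _ hj) i (by omega)
  have eB : (S.protocol t z₀ N φ).outB y r
      (((S.protocol t z₀ N φ).transcript x y r eve).map Round.recvB) =
      (t.subtree (walk (S.opB m' b' ω (S.rcvB m b m' b' ω eve)) N)).rootOut z₀ := by
    rw [transcript_protocol, map_recvB_run]
    change (t.subtree (walk (S.opB m' b' ω _) N)).rootOut z₀ = _
    congr 2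
    exact walk_congr fun i hi => walk_opB_congr (Nat.mul_lt_mul_of_pos_left hi S.len_pos)
      (fun _ _ => rfl) (fun j hj => asSeq_map_range _ hj) i le_rfl
  refine ⟨?_, ?_⟩
  · rw [eA, t.rootOut_subtree x y z₀ (hn.le.trans hA), ht x y]
  · rw [eB, t.rootOut_subtree x y z₀ (hn.le.trans hB), ht x y]

/-- For a fixed deterministic adversary, failure within the noise bound forces at least `n`
forgeries, and the tags are long enough to beat the factor `2` per round in the moment bound. -/
theorem failureProb_protocol_le {t : ProtocolTree X Y Z} {f : X → Y → Z} (ht : t.Computes f)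
    (z₀ : Z) {n h N : ℕ} (hn : t.depth = n) {ε : ℝ} (hε1 : ε < 1) (henc : IsTreeCode h N S.enc)
    (hh : h = 32 * (S.reps * S.len)) (hr : 0 < S.reps) (hN : N = h * n) (hcap : S.cap = 9 * n)
    (hε : 2 ≤ ε * S.len) (hTag : Fintype.card Tag = 2 ^ (2 * (S.len * h))) {seedLen : ℕ}
    (φ : (Fin seedLen → Bool) ≃ (Fin (S.len * N) → F → Tag)) (x : X) (y : Y)
    (eve : PMF (Adversary Γ)) :
    (S.protocol t z₀ N φ).failureProb f (ENNReal.ofReal (1 - ε)) x y eve ≤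
      ENNReal.ofReal ((2 : ℝ) ^ (-(n : ℝ))) := by
  classical
  refine toOuterMeasure_uniform_bind_le (Ω := Fin seedLen → Bool) eve _ _ fun e A hAbad => ?_
  have hcard : Fintype.card (Fin seedLen → Bool) = Fintype.card (F → Tag) ^ (S.len * N) := by
    rw [Fintype.card_congr φ, Fintype.card_fun, Fintype.card_fin]
  have hmany := card_many_forged_le (m := fun v => (t.subtree v).rootAlice)
    (b := fun v => (t.subtree v).rootBitA x) (m' := fun v => !(t.subtree v).rootAlice)
    (b' := fun v => (t.subtree v).rootBitB y) henc.causal e (S.len * N) n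
  have hA : A.card ≤ (Finset.univ.filter fun ω : Fin (S.len * N) → F → Tag => n ≤ ((Finset.range (S.len * N)).filter
      fun i => S.Forged (fun v => (t.subtree v).rootAlice) (fun v => (t.subtree v).rootBitA x)
        (fun v => !(t.subtree v).rootAlice) (fun v => (t.subtree v).rootBitB y)
        (extend ω) e i).card).card := by
    refine Finset.card_le_card_of_injOn φ ?_ φ.injective.injOn
    intro r hbad
    replace hbad := hAbad r hbad
    simp only [Finset.coe_filter, Finset.mem_univ, true_and, Set.mem_ofPred_eq]
    by_contra hlt
    exact hbad.2 (correct_protocol ht z₀ hn hε1 henc hh hr hN hcap hε φ x y r e hbad.1 (by omega))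
  have hTn : n ≤ S.len * N := by
    have h0 : 0 < h := by rw [hh]; exact Nat.mul_pos (by norm_num) (Nat.mul_pos hr S.len_pos)
    calc n = 1 * (1 * n) := by ring
      _ ≤ S.len * (h * n) := Nat.mul_le_mul S.len_pos (Nat.mul_le_mul_right _ h0)
      _ = S.len * N := by rw [hN]
  have hfin : 2 ^ n * A.card ≤ Fintype.card (Fin seedLen → Bool) := by
    rw [hcard]
    refine Nat.le_of_mul_le_mul_left ?_ (show 0 < 2 ^ (S.len * N) by positivity)
    -- The tag length is chosen so that `|Tag| ^ n` is the square of `2 ^ (len * N)`: one factor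
    -- cancels the moment bound, and the other is at least `2 ^ n`.
    have hpow : Fintype.card Tag ^ n = 2 ^ (S.len * N) * 2 ^ (S.len * N) := by
      rw [hTag, ← pow_mul, ← pow_add, hN]
      congr 1
      ring
    rw [hpow] at hmany
    calc 2 ^ (S.len * N) * (2 ^ n * A.card) ≤ 2 ^ (S.len * N) * (2 ^ (S.len * N) * A.card) := by
          gcongr
          norm_num
      _ = A.card * (2 ^ (S.len * N) * 2 ^ (S.len * N)) := by ring
      _ ≤ _ := (Nat.mul_le_mul_right _ hA).trans hmany
  have h2 : ENNReal.ofReal ((2 : ℝ) ^ (-(n : ℝ))) = ((2 : ℝ≥0∞) ^ n)⁻¹ := by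
    rw [Real.rpow_neg (by norm_num), Real.rpow_natCast, ENNReal.ofReal_inv_of_pos (by positivity),
      ENNReal.ofReal_pow (by norm_num)]
    norm_num
  rw [h2]
  refine (ENNReal.mul_le_iff_le_inv (by simp) (by simp)).mp ?_
  exact_mod_cast hfin

end Scheme

theorem exists_depth_eq_commComplexity {X Y Z : Type*} [Finite X] [Finite Y] [Nonempty X]
    [Nonempty Y] (f : X → Y → Z) :
    ∃ t : ProtocolTree X Y Z, t.Computes f ∧ t.depth = commComplexity f := by
  obtain ⟨t, ht⟩ := exists_computes f
  exact Nat.sInf_mem (s := {n | ∃ t : ProtocolTree X Y Z, t.Computes f ∧ t.depth = n})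
    ⟨t.depth, t, ht, rfl⟩

theorem exists_scheme_parameters (ε : ℝ) (hε : 0 < ε) :
    ∃ k : ℕ, 0 < k ∧ 2 ≤ ε * ((k + 1 : ℕ) : ℝ) := by
  refine ⟨⌈2 / ε⌉₊, Nat.ceil_pos.mpr (by positivity), ?_⟩
  have h1 : 2 / ε ≤ (⌈2 / ε⌉₊ : ℝ) := Nat.le_ceil _
  rw [div_le_iff₀ hε] at h1
  push_cast
  nlinarith

end AdaptiveComm

theorem theorem6 :
    ∃ ε₀ : ℝ, 0 < ε₀ ∧ ∀ ε : ℝ, 0 < ε → ε < ε₀ →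
      ∃ (s C : ℕ) (c : ℝ), 0 < c ∧
        ∀ (X : Type u) (Y : Type v) (Z : Type w) [Finite X] [Finite Y] [Finite Z]
          [Nonempty X] [Nonempty Y] (f : X → Y → Z),
          ∃ P : AdaptiveComm.SharedProtocol X Y Z (Fin s),
            P.rounds ≤ C * AdaptiveComm.commComplexity f ∧
            ∀ (x : X) (y : Y) (eve : PMF (AdaptiveComm.Adversary (Fin s))),
              P.failureProb f (ENNReal.ofReal (1 - ε)) x y eve ≤
                ENNReal.ofReal ((2 : ℝ) ^ (-(c * (AdaptiveComm.commComplexity f : ℝ)))) := by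
  refine ⟨1, one_pos, fun ε hε hε1 => ?_⟩
  obtain ⟨k, hk, hkε⟩ := AdaptiveComm.exists_scheme_parameters ε hε
  obtain ⟨h, hh⟩ : ∃ h, h = 32 * (k * (k + 1)) := ⟨_, rfl⟩
  have hh0 : 0 < h := by rw [hh]; positivity
  obtain ⟨q, -, henc⟩ := AdaptiveComm.exists_isTreeCode AdaptiveComm.Op h hh0
  refine ⟨q * 2 ^ (2 * ((k + 1) * h)), (k + 1) * h, 1, one_pos, ?_⟩
  intro X Y Z _ _ _ _ _ f
  obtain ⟨t, ht, hn⟩ := AdaptiveComm.exists_depth_eq_commComplexity f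
  set n := AdaptiveComm.commComplexity f
  obtain ⟨x₀⟩ := ‹Nonempty X›
  obtain ⟨y₀⟩ := ‹Nonempty Y›
  obtain ⟨enc, hcode⟩ := henc (h * n)
  let S : AdaptiveComm.Scheme (Fin q) (Fin (2 * ((k + 1) * h)) → Bool)
      (Fin (q * 2 ^ (2 * ((k + 1) * h)))) :=
    { reps := k
      format := Fintype.equivFinOfCardEq (by simp)
      enc := enc
      cap := 9 * n }
  -- One key per round is a table of `q` tags. Tags are bit strings, so uniform seeds correspond
  -- bijectively to uniform families of keys.
  let φ : (Fin (2 * ((k + 1) * h) * q * (S.len * (h * n))) → Bool) ≃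
      (Fin (S.len * (h * n)) → Fin q → Fin (2 * ((k + 1) * h)) → Bool) :=
    Fintype.equivOfCardEq (by simp [pow_mul])
  refine ⟨S.protocol t (f x₀ y₀) (h * n) φ, ?_, fun x y eve => ?_⟩
  · change (k + 1) * (h * n) ≤ _
    rw [mul_assoc]
  · rw [one_mul]
    exact AdaptiveComm.Scheme.failureProb_protocol_le (S := S) ht _ hn hε1 hcode hh hk rfl rfl
      hkε (by simp [S, AdaptiveComm.Scheme.len]) φ x y eve
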